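/- Let $K$ be a field and let $n_1<n_2<n_3<n_4$ be positive integers with $\gcd(n_1,\dots,n_4)=1$. Let $C\subset\mathbb A^4(K)$ be the monomial curve $x_1=t^{n_1},\dots,x_4=t^{n_4}$, let $I(C)$ be its toric ideal, i.e. the kernel of the $K$-algebra homomorphism $K[x_1,\dots,x_4]\to K[t]$, $x_i\mapsto t^{n_i}$, and let $\mathcal S=\mathbb N n_1+\cdots+\mathbb N n_4$. For a monomial $M=\mathbf x^{\mathbf u}$ write $\deg(M)=\sum_l u_l$, $\deg_{\mathcal S}(M)=\sum_l u_l n_l$ and $\operatorname{supp}(M)=\{l : u_l>0\}$. We say that $C$ has Cohen–Macaulay tangent cone at the origin if the ring $K[x_1,\dots,x_4]/I(C)_*$ is Cohen–Macaulay, where $I(C)_*$ is generated by the homogeneous summands of least degree of the elements of $I(C)$. For each $l$ let $a_l$ be the least positive integer with $a_l n_l\in\sum_{m\ne l}\mathbb N n_m$. The critical ideal is the ideal generated by all binomials of $I(C)$ of the form $x_l^{a_l}-\mathbf x^{\mathbf u}$ with $u_l=0$, $1\le l\le 4$. Suppose that the Katsabekis–Ojeda case 2(b) holds: for some $i,j,k$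 with $\{i,j,k\}=\{2,3,4\}$ we have $a_1n_1=a_in_i$, $a_jn_j=a_kn_k$, $a_in_i\neq a_jn_j$, and the critical ideal is generated by $x_1^{a_1}-x_i^{a_i}$ and $x_j^{a_j}-x_k^{a_k}$. Assume $n_k>n_j$. A monomial is called indispensable if every generating set of $I(C)$ consisting of binomials (differences of two distinct monomials) has an element in which it occurs. Let $\mathcal I$ be the set of all binomials $x_p^{u_p}x_q^{u_q}-x_r^{u_r}x_s^{u_s}\in I(C)$ with $\{p,q,r,s\}=\{1,2,3,4\}$, $0<u_p<a_p$, $0<u_q<a_q$, $u_r>0$, $u_s>0$ and $x_r^{u_r}x_s^{u_s}$ indispensable. Let $\mathcal R$ be the set of all binomials $x_1^{u_1}x_i^{u_i}-x_j^{u_j}x_k^{u_k}\in I(C)\setminus\mathcal I$ with all four exponents positive, with $u_1\le a_1$ or $u_j\le a_j$ (or both), such that there is no binomial $x_1^{v_1}x_i^{v_i}-x_j^{v_j}x_k^{v_k}\in I(C)$ with all four exponents positive for which, for some $\alpha\in\mathbb N$, either $\alpha a_i\le u_i$ and $x_1^{v_1}x_i^{v_i}$ properly divides $x_1^{u_1+\alpha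 a_1}x_i^{u_i-\alpha a_i}$, or $\alpha a_k\le u_k$ and $x_j^{v_j}x_k^{v_k}$ properly divides $x_j^{u_j+\alpha a_j}x_k^{u_k-\alpha a_k}$. Then $C$ has Cohen–Macaulay tangent cone at the origin if and only if the following three conditions hold: 1. for every $f=M-N\in\mathcal I$ ($M,N$ monomials) with $1\in\operatorname{supp}(M)$, we have $\deg(N)\le\deg(M)$; 2. for every $f=M-N\in\mathcal R$ ($M,N$ monomials) with $1\in\operatorname{supp}(M)$, there is a monomial $P$ with $1\in\operatorname{supp}(P)$, $\deg_{\mathcal S}(N)=\deg_{\mathcal S}(P)$ and $\deg(N)\le\deg(P)$; 3. for every monomial $M=x_i^{u_i}x_j^{u_j}x_k^{u_k}$ with $u_i<a_i$, $u_j\ge a_j$, $u_k<a_k$ and $\deg_{\mathcal S}(M)\in n_1+\mathcal S$, there is a monomial $N$ with $1\in\operatorname{supp}(N)$, $M-N\in I(C)$ and $\deg(M)\le\deg(N)$. -/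

import Mathlib

open MvPolynomial

namespace MonomialCurve

/-! ### Cohen–Macaulay rings -/

/-- A Noetherian local ring is Cohen–Macaulay if its maximal ideal contains a regular sequence whose
length is the Krull dimension of the ring (that is, depth equals dimension). -/
def IsCohenMacaulayLocalRing (R : Type*) [CommRing R] [IsLocalRing R] : Prop :=
  IsNoetherianRing R ∧
    ∃ rs : List R, (∀ r ∈ rs, r ∈ IsLocalRing.maximalIdeal R) ∧
      RingTheory.Sequence.IsRegular R rs ∧ ringKrullDim R = rs.length

/-- A Noetherian ring is Cohen–Macaulay if all its localizations at maximal ideals are. -/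
def IsCohenMacaulayRing (R : Type*) [CommRing R] : Prop :=
  IsNoetherianRing R ∧
    ∀ (m : Ideal R) [m.IsMaximal], IsCohenMacaulayLocalRing (Localization.AtPrime m)

/-! ### Monomial curves in affine 4-space

The variables `x₁, x₂, x₃, x₄` and the integers `n₁, n₂, n₃, n₄` are indexed by `0, 1, 2, 3 : Fin 4`.
A monomial `x^u` is represented by its exponent vector `u : Fin 4 →₀ ℕ`, so `u.support` is its
support and `u.degree` its degree. -/

section Curve

variable (K : Type*) [Field K] (n : Fin 4 → ℕ)

/-- The monomial `x^u` as a polynomial. -/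
noncomputable def mon (u : Fin 4 →₀ ℕ) : MvPolynomial (Fin 4) K := monomial u 1

/-- The toric ideal `I(C)`: the kernel of `K[x₁, …, x₄] → K[t]`, `xᵢ ↦ t ^ nᵢ`. -/
noncomputable def toricIdeal : Ideal (MvPolynomial (Fin 4) K) :=
  RingHom.ker (aeval fun i => (Polynomial.X : Polynomial K) ^ n i)

/-- The homogeneous summand `f_*` of least degree of a polynomial `f`. -/
noncomputable def leastForm (f : MvPolynomial (Fin 4) K) : MvPolynomial (Fin 4) K :=
  homogeneousComponent (sInf {d : ℕ | homogeneousComponent d f ≠ 0}) f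

/-- The ideal `I_*` generated by the least-degree forms of the elements of `I`. -/
noncomputable def leastFormIdeal (I : Ideal (MvPolynomial (Fin 4) K)) :
    Ideal (MvPolynomial (Fin 4) K) :=
  Ideal.span (leastForm K '' (I : Set (MvPolynomial (Fin 4) K)))

/-- The curve `C` has Cohen–Macaulay tangent cone at the origin. -/
def HasCohenMacaulayTangentCone : Prop :=
  IsCohenMacaulayRing (MvPolynomial (Fin 4) K ⧸ leastFormIdeal K (toricIdeal K n))

/-- The numerical semigroup `𝒮` generated by `n₁, …, n₄`. -/
def semigroup : AddSubmonoid ℕ := AddSubmonoid.closure (Set.range n)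

/-- The `𝒮`-degree of the monomial `x^u`. -/
def degS (u : Fin 4 →₀ ℕ) : ℕ := ∑ i, u i * n i

/-- The least positive integer `aᵢ` such that `aᵢ nᵢ` is a combination, with coefficients in `ℕ`,
of the `nⱼ` with `j ≠ i`. -/
noncomputable def critExp (i : Fin 4) : ℕ :=
  sInf {a : ℕ | 0 < a ∧ a * n i ∈ AddSubmonoid.closure (n '' {j | j ≠ i})}

/-- The critical binomials of `I(C)` with respect to `xᵢ`. -/
noncomputable def criticalBinomials (i : Fin 4) : Set (MvPolynomial (Fin 4) K) :=
  {f | f ∈ toricIdeal K n ∧ ∃ u : Fin 4 →₀ ℕ, u i = 0 ∧ f = X i ^ critExp n i - mon K u}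

/-- The critical ideal, generated by all critical binomials of `I(C)`. -/
noncomputable def criticalIdeal : Ideal (MvPolynomial (Fin 4) K) :=
  Ideal.span (⋃ i, criticalBinomials K n i)

/-- A binomial is a difference of two distinct monomials. -/
def IsBinomial (f : MvPolynomial (Fin 4) K) : Prop :=
  ∃ u v : Fin 4 →₀ ℕ, u ≠ v ∧ f = mon K u - mon K v

/-- The monomial `x^u` is indispensable: it is a monomial of some element of every system of
binomial generators of `I(C)`. -/
def IsIndispensableMonomial (u : Fin 4 →₀ ℕ) : Prop :=
  ∀ G : Set (MvPolynomial (Fin 4) K), (∀ g ∈ G, IsBinomial K g) →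
    Ideal.span G = toricIdeal K n → ∃ g ∈ G, u ∈ g.support

/-- The set `𝓘` of the binomials
`x_p ^ u_p x_q ^ u_q - x_r ^ u_r x_s ^ u_s` in `I(C)` with `{p, q, r, s} = {1, 2, 3, 4}`,
`0 < u_p < a_p`, `0 < u_q < a_q`, `0 < u_r`, `0 < u_s` and `x_r ^ u_r x_s ^ u_s` indispensable. -/
def setI : Set (MvPolynomial (Fin 4) K) :=
  {f | f ∈ toricIdeal K n ∧ ∃ (p q r s : Fin 4) (v w : Fin 4 →₀ ℕ),
    [p, q, r, s].Nodup ∧ v.support = {p, q} ∧ w.support = {r, s} ∧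
    v p < critExp n p ∧ v q < critExp n q ∧
    IsIndispensableMonomial K n w ∧ f = mon K v - mon K w}

/-- `x^v'` properly divides `x_p ^ (u_p + α a_p) x_q ^ (u_q - α a_q)` for some `α ∈ ℕ` for which the
latter is a monomial, where `x^u = x_p ^ u_p x_q ^ u_q`. -/
def ProperlyDividesShift (p q : Fin 4) (v' u : Fin 4 →₀ ℕ) : Prop :=
  ∃ α : ℕ, α * critExp n q ≤ u q ∧
    v' < u + Finsupp.single p (α * critExp n p) - Finsupp.single q (α * critExp n q)

/-- The set `𝓡` for a curve whose critical ideal is generated by `x₁ ^ a₁ - xᵢ ^ aᵢ` and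
`xⱼ ^ aⱼ - xₖ ^ aₖ`: the binomials `x₁ ^ u₁ xᵢ ^ uᵢ - xⱼ ^ uⱼ xₖ ^ uₖ` in `I(C)` outside `𝓘`, with
full support, with `u₁ ≤ a₁` or `uⱼ ≤ aⱼ`, for which no binomial
`x₁ ^ v₁ xᵢ ^ vᵢ - xⱼ ^ vⱼ xₖ ^ vₖ` in `I(C)` with full support has a monomial properly dividing a
monomial `x₁ ^ (u₁ + α a₁) xᵢ ^ (uᵢ - α aᵢ)` or `xⱼ ^ (uⱼ + α aⱼ) xₖ ^ (uₖ - α aₖ)`,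
respectively. -/
def setR (i j k : Fin 4) : Set (MvPolynomial (Fin 4) K) :=
  {f | f ∈ toricIdeal K n ∧ f ∉ setI K n ∧ ∃ v w : Fin 4 →₀ ℕ,
    v.support = {0, i} ∧ w.support = {j, k} ∧ f = mon K v - mon K w ∧
    (v 0 ≤ critExp n 0 ∨ w j ≤ critExp n j) ∧
    ¬ ∃ v' w' : Fin 4 →₀ ℕ, v'.support = {0, i} ∧ w'.support = {j, k} ∧
      mon K v' - mon K w' ∈ toricIdeal K n ∧
      (ProperlyDividesShift n 0 i v' v ∨ ProperlyDividesShift n j k w' w)}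

/-- Case 2(b) of the classification, with the indices named so that the critical ideal is generated
by `x₁ ^ a₁ - xᵢ ^ aᵢ` and `xⱼ ^ aⱼ - xₖ ^ aₖ`. -/
structure IsCase2b (i j k : Fin 4) : Prop where
  indices : [0, i, j, k].Nodup
  deg_left : critExp n 0 * n 0 = critExp n i * n i
  deg_right : critExp n j * n j = critExp n k * n k
  deg_ne : critExp n i * n i ≠ critExp n j * n j
  span_eq : criticalIdeal K n = Ideal.span
    {X 0 ^ critExp n 0 - X i ^ critExp n i, X j ^ critExp n j - X k ^ critExp n k}

end Curve

end MonomialCurve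

namespace MonomialCurve

variable {K : Type*} [Field K] {n : Fin 4 → ℕ}

/-! ### Monomials, `𝒮`-degrees and the toric ideal -/

/-! Call a monomial top if its degree is largest among the monomials of its `𝒮`-degree. The ideal
`I(C)_*` is the kernel of the map sending a top monomial to `t ^ deg_𝒮` and every other monomial to
0 (`mem_leastFormIdeal`). Modulo nilpotents the tangent cone is the polynomial ring in `x₀`, so all
its localizations at maximal ideals have dimension 1. Cohen–Macaulayness then means that `x₀` is a
nonzerodivisor, that is, that multiplication by `x₀` keeps top monomials top
(`hasCohenMacaulayTangentCone_iff`). Equivalently, any monomial `M` with an equivalent monomial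
divisible by `x₀` has one of degree at least `deg M` (`LiftsToZero`).

Conditions 2 and 3 are instances of this property. For condition 1, isolation of the indispensable
monomial and the exponent bounds force the lifted monomial to be the given one
(`degree_le_of_mem_setI`).

For the converse (`IsCase2b.liftsToZero`), use strong induction on the `𝒮`-degree. Since `n₀ < nᵢ`
and `nⱼ < nₖ`, replacing `xᵢ ^ aᵢ` by `x₀ ^ a₀`, or `xₖ ^ aₖ` by `xⱼ ^ aⱼ`, raises the degree. This
leaves exponents of `xᵢ` and `xₖ` below the critical ones; if that of `xⱼ` is not, condition 3
applies. Otherwise, a variable shared with an equivalent monomial divisible by `x₀` is cancelled. If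
none is shared, `M` is isolated, hence indispensable, and minimality of the critical exponents
(`NumCase.cases`) leaves only binomials in `𝓘` or `𝓡`, to which conditions 1 and 2 apply. -/

lemma degS_add (u v : Fin 4 →₀ ℕ) : degS n (u + v) = degS n u + degS n v := by
  simp [degS, add_mul, Finset.sum_add_distrib]

lemma degS_single (i : Fin 4) (c : ℕ) : degS n (Finsupp.single i c) = c * n i := by
  unfold degS
  rw [Finset.sum_eq_single i]
  · simp
  · intro b _ hb
    simp [hb.symm]
  · simp

@[simp] lemma degS_zero : degS n 0 = 0 := by simp [degS]

lemma degree_le_degS (hn : ∀ i, 0 < n i) (u : Fin 4 →₀ ℕ) : u.degree ≤ degS n u := by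
  rw [Finsupp.degree_eq_sum, degS]
  exact Finset.sum_le_sum fun i _ => Nat.le_mul_of_pos_right _ (hn i)

lemma eq_zero_of_degS_eq_zero (hn : ∀ i, 0 < n i) {u : Fin 4 →₀ ℕ} (h : degS n u = 0) :
    u = 0 := by
  have := degree_le_degS hn u
  rw [h] at this
  exact (Finsupp.degree_eq_zero_iff u).1 (Nat.le_zero.1 this)

lemma mon_mul (u v : Fin 4 →₀ ℕ) : mon K u * mon K v = mon K (u + v) := by
  simp [mon, monomial_mul]

lemma X_pow_eq_mon (i : Fin 4) (c : ℕ) :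
    (X i : MvPolynomial (Fin 4) K) ^ c = mon K (Finsupp.single i c) := by
  simp [mon, X_pow_eq_monomial]

lemma X_eq_mon (i : Fin 4) :
    (X i : MvPolynomial (Fin 4) K) = mon K (Finsupp.single i 1) := rfl

lemma coeff_mon (u v : Fin 4 →₀ ℕ) : coeff u (mon K v) = if v = u then 1 else 0 := by
  simp [mon, coeff_monomial]

/-- Linear maps on polynomials agree when they agree on all monomials. -/
lemma linearMap_ext {V : Type*} [AddCommGroup V] [Module K V]
    {f g : MvPolynomial (Fin 4) K →ₗ[K] V} (h : ∀ u, f (mon K u) = g (mon K u)) : f = g :=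
  (basisMonomials (Fin 4) K).ext fun u => by simpa [mon] using h u

lemma aeval_mon (u : Fin 4 →₀ ℕ) :
    aeval (fun i => (Polynomial.X : Polynomial K) ^ n i) (mon K u) =
      Polynomial.X ^ degS n u := by
  rw [mon, aeval_monomial, map_one, one_mul, degS, Finsupp.prod_fintype _ _ (by simp),
    ← Finset.prod_pow_eq_pow_sum]
  exact Finset.prod_congr rfl fun i _ => by rw [← pow_mul, mul_comm]

lemma mon_sub_mon_mem_toricIdeal {u v : Fin 4 →₀ ℕ} :
    mon K u - mon K v ∈ toricIdeal K n ↔ degS n u = degS n v := by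
  rw [toricIdeal, RingHom.mem_ker, map_sub, aeval_mon, aeval_mon, sub_eq_zero]
  constructor
  · intro h
    simpa using congrArg Polynomial.natDegree h
  · intro h
    rw [h]

lemma mon_injective : Function.Injective (mon K) := fun u v h => by
  by_contra hne
  have := congrArg (coeff u) h
  rw [coeff_mon, coeff_mon, if_pos rfl, if_neg fun h => hne h.symm] at this
  exact one_ne_zero this

/-- The two monomials of a binomial are determined up to order. -/
lemma mon_sub_mon_eq {u v a b : Fin 4 →₀ ℕ} (hab : a ≠ b)
    (h : mon K u - mon K v = mon K a - mon K b) : (u = a ∧ v = b) ∨ (u = b ∧ v = a) := by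
  have huv : u ≠ v := by
    rintro rfl
    rw [sub_self] at h
    exact hab (mon_injective (sub_eq_zero.1 h.symm))
  have h1 := congrArg (coeff u) h
  simp only [coeff_sub, coeff_mon, if_true, if_neg huv.symm] at h1
  by_cases ha : a = u
  · subst ha
    left
    exact ⟨rfl, mon_injective (sub_right_injective h)⟩
  · by_cases hb : b = u
    · subst hb
      right
      refine ⟨rfl, ?_⟩
      have h2 := congrArg (coeff v) h
      simp only [coeff_sub, coeff_mon, if_true, if_neg huv] at h2
      by_contra hv
      rw [if_neg fun h => hv h.symm] at h2
      have h3 := congrArg (coeff a) h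
      simp only [coeff_sub, coeff_mon, if_true, if_neg (Ne.symm ha), if_neg hv] at h3
      simp at h3
    · rw [if_neg ha, if_neg hb] at h1
      simp at h1

lemma support_mon_sub_mon {u v : Fin 4 →₀ ℕ} (h : u ≠ v) :
    (mon K u - mon K v).support = {u, v} := by
  ext w
  rw [mem_support_iff, coeff_sub, coeff_mon, coeff_mon]
  by_cases h1 : u = w
  · subst h1
    simp [h.symm]
  · by_cases h2 : v = w
    · subst h2
      simp [h]
    · simp [h1, h2, eq_comm]

/-! ### Semigroup membership, critical exponents and generation of the toric ideal. -/

lemma mem_closure_image {T : Set (Fin 4)} {s : ℕ} :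
    s ∈ AddSubmonoid.closure (n '' T) ↔ ∃ u : Fin 4 →₀ ℕ, (∀ l, l ∉ T → u l = 0) ∧ degS n u = s := by
  constructor
  · intro h
    induction h using AddSubmonoid.closure_induction with
    | mem x hx =>
      obtain ⟨l, hl, rfl⟩ := hx
      refine ⟨Finsupp.single l 1, fun m hm => ?_, by rw [degS_single, one_mul]⟩
      rw [Finsupp.single_apply, if_neg]
      rintro rfl
      exact hm hl
    | zero => exact ⟨0, by simp, by simp⟩
    | add x y _ _ hx hy =>
      obtain ⟨u, hu, rfl⟩ := hx
      obtain ⟨v, hv, rfl⟩ := hy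
      exact ⟨u + v, fun l hl => by simp [hu l hl, hv l hl], degS_add u v⟩
  · rintro ⟨u, hu, rfl⟩
    refine sum_mem fun l _ => ?_
    by_cases hl : l ∈ T
    · rw [← smul_eq_mul]
      exact nsmul_mem (AddSubmonoid.subset_closure (Set.mem_image_of_mem n hl)) _
    · rw [hu l hl, zero_mul]
      exact zero_mem _

lemma mem_semigroup {s : ℕ} : s ∈ semigroup n ↔ ∃ u : Fin 4 →₀ ℕ, degS n u = s := by
  rw [semigroup, ← Set.image_univ, mem_closure_image]
  simp

lemma critExp_le {l : Fin 4} {c : ℕ} (hc : 0 < c) {u : Fin 4 →₀ ℕ} (hu : u l = 0)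
    (h : c * n l = degS n u) : critExp n l ≤ c := by
  refine Nat.sInf_le ⟨hc, mem_closure_image.2 ⟨u, fun m hm => ?_, h.symm⟩⟩
  have : m = l := by simpa using hm
  rw [this, hu]

lemma critExp_pos (hn : ∀ i, 0 < n i) (l : Fin 4) : 0 < critExp n l := by
  obtain ⟨m, hm⟩ : ∃ m : Fin 4, m ≠ l := exists_ne l
  have hne : {a : ℕ | 0 < a ∧ a * n l ∈ AddSubmonoid.closure (n '' {j | j ≠ l})}.Nonempty := by
    refine ⟨n m, hn m, ?_⟩
    rw [mul_comm, ← smul_eq_mul]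
    exact nsmul_mem (AddSubmonoid.subset_closure (Set.mem_image_of_mem n hm)) _
  exact (Nat.sInf_mem hne).1

/-- If `ψ (π f) ≡ f` modulo an ideal for all monomials `f`, then the ideal contains `ker π`. -/
lemma mem_of_map_eq_zero {V : Type*} [AddCommGroup V] [Module K V]
    (π : MvPolynomial (Fin 4) K →ₗ[K] V) (ψ : V →ₗ[K] MvPolynomial (Fin 4) K)
    (J : Ideal (MvPolynomial (Fin 4) K)) (h : ∀ u, mon K u - ψ (π (mon K u)) ∈ J)
    {f : MvPolynomial (Fin 4) K} (hf : π f = 0) : f ∈ J := by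
  have key : ((J.restrictScalars K).mkQ).comp (LinearMap.id - ψ.comp π) = 0 :=
    linearMap_ext fun u => by
      simpa [Submodule.Quotient.mk_eq_zero, Submodule.mkQ_apply, ← Submodule.Quotient.mk_sub]
        using h u
  have := LinearMap.congr_fun key f
  simpa [hf, Submodule.mkQ_apply, Submodule.Quotient.mk_eq_zero] using this

/-- An ideal containing all pure binomials `x^u - x^v` of `I(C)` contains `I(C)`. -/
lemma toricIdeal_le {J : Ideal (MvPolynomial (Fin 4) K)}
    (h : ∀ u v, degS n u = degS n v → mon K u - mon K v ∈ J) : toricIdeal K n ≤ J := by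
  classical
  intro f hf
  -- A chosen monomial in each `𝒮`-degree; the value 0 outside the semigroup plays no role.
  let c : ℕ → (Fin 4 →₀ ℕ) := fun s =>
    if hs : ∃ u : Fin 4 →₀ ℕ, degS n u = s then hs.choose else 0
  have hc : ∀ u, degS n (c (degS n u)) = degS n u := fun u => by
    have hs : ∃ v : Fin 4 →₀ ℕ, degS n v = degS n u := ⟨u, rfl⟩
    simp only [c, dif_pos hs]
    exact hs.choose_spec
  refine mem_of_map_eq_zero
    (aeval fun i => (Polynomial.X : Polynomial K) ^ n i).toLinearMap
    ((Polynomial.basisMonomials K).constr K fun s => mon K (c s)) J (fun u => ?_) hf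
  have : (Polynomial.X : Polynomial K) ^ degS n u = Polynomial.basisMonomials K (degS n u) := by
    simp [Polynomial.X_pow_eq_monomial]
  rw [AlgHom.toLinearMap_apply, aeval_mon, this, Module.Basis.constr_basis]
  exact h _ _ (hc u).symm

/-- The sum of the coefficients of an element of `I(C)` over a fixed `𝒮`-degree vanishes. -/
lemma sum_coeff_eq_zero {f : MvPolynomial (Fin 4) K} (hf : f ∈ toricIdeal K n) (s : ℕ) :
    ∑ u ∈ f.support with degS n u = s, coeff u f = 0 := by
  have h : aeval (fun i => (Polynomial.X : Polynomial K) ^ n i) f = 0 := hf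
  rw [f.as_sum, map_sum] at h
  have h2 := congrArg (fun p => Polynomial.coeff p s) h
  simp only [Polynomial.finsetSum_coeff, Polynomial.coeff_zero] at h2
  rw [Finset.sum_filter]
  refine (Finset.sum_congr rfl fun u _ => ?_).trans h2
  have : monomial u (coeff u f) = coeff u f • mon K u := by simp [mon, smul_monomial]
  rw [this, map_smul, aeval_mon, Polynomial.coeff_smul, Polynomial.coeff_X_pow]
  simp [eq_comm]

/-! ### Indispensable monomials -/

/-- No other monomial of the same `𝒮`-degree shares a variable with `x^w`. -/
def IsIsolated (n : Fin 4 → ℕ) (w : Fin 4 →₀ ℕ) : Prop :=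
  ∀ q, degS n q = degS n w → q ≠ w → ∀ l, 0 < w l → q l = 0

/-- If `x^w` and an equivalent `x^q` share `x_l`, then `x^w - x^q` is `x_l` times a binomial of
smaller `𝒮`-degree. The binomials of `I(C)` avoiding `x^w` therefore already generate `I(C)`. -/
lemma IsIsolated.of_isIndispensableMonomial (hn : ∀ i, 0 < n i) {w : Fin 4 →₀ ℕ}
    (hw : IsIndispensableMonomial K n w) : IsIsolated n w := by
  by_contra hiso
  simp only [IsIsolated, not_forall] at hiso
  obtain ⟨q, hq, hqw, l, hwl, hql⟩ := hiso
  have hql : 0 < q l := Nat.pos_of_ne_zero hql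
  let G : Set (MvPolynomial (Fin 4) K) :=
    {f | ∃ a b, a ≠ b ∧ a ≠ w ∧ b ≠ w ∧ degS n a = degS n b ∧ f = mon K a - mon K b}
  have hG : ∀ a b, a ≠ w → b ≠ w → degS n a = degS n b → mon K a - mon K b ∈ Ideal.span G := by
    intro a b ha hb hab
    by_cases h : a = b
    · rw [h, sub_self]
      exact zero_mem _
    · exact Ideal.subset_span ⟨a, b, h, ha, hb, hab, rfl⟩
  have hwq : mon K w - mon K q ∈ Ideal.span G := by
    obtain ⟨w', rfl⟩ : ∃ w', w = Finsupp.single l 1 + w' :=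
      exists_add_of_le (Finsupp.single_le_iff.2 hwl)
    obtain ⟨q', rfl⟩ : ∃ q', q = Finsupp.single l 1 + q' :=
      exists_add_of_le (Finsupp.single_le_iff.2 hql)
    rw [degS_add, degS_add] at hq
    rw [← mon_mul, ← mon_mul, ← mul_sub]
    have hnl := hn l
    refine Ideal.mul_mem_left _ _ (hG _ _ ?_ ?_ (by omega))
    · intro h
      have h2 := congrArg (degS n) h
      rw [degS_add, degS_single] at h2
      omega
    · intro h
      have h2 := congrArg (degS n) h
      rw [degS_add, degS_single] at h2
      omega
  have hw2 : ∀ b, b ≠ w → degS n w = degS n b → mon K w - mon K b ∈ Ideal.span G := by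
    intro b hb h
    rw [← sub_add_sub_cancel _ (mon K q)]
    exact add_mem hwq (hG _ _ hqw hb (hq.trans h))
  have hspan : Ideal.span G = toricIdeal K n := by
    apply le_antisymm
    · rw [Ideal.span_le]
      rintro _ ⟨a, b, -, -, -, hab, rfl⟩
      exact mon_sub_mon_mem_toricIdeal.2 hab
    · refine toricIdeal_le fun u v huv => ?_
      by_cases hu : u = w
      · by_cases hv : v = w
        · rw [hu, hv, sub_self]
          exact zero_mem _
        · subst hu
          exact hw2 v hv huv
      · by_cases hv : v = w
        · subst hv
          rw [← neg_sub]
          exact neg_mem (hw2 u hu huv.symm)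
        · exact hG _ _ hu hv huv
  obtain ⟨g, ⟨a, b, hab, ha, hb, -, rfl⟩, hg⟩ := hw G
    (by rintro _ ⟨a, b, hab, -, -, -, rfl⟩; exact ⟨a, b, hab, rfl⟩) hspan
  rw [support_mon_sub_mon hab] at hg
  simp only [Finset.mem_insert, Finset.mem_singleton] at hg
  rcases hg with h | h
  · exact ha h.symm
  · exact hb h.symm

/-- If no monomial multiple of an element of `G` contains `x^w`, no element of `(G)` does. -/
lemma coeff_eq_zero_of_mem_span {G : Set (MvPolynomial (Fin 4) K)} {w : Fin 4 →₀ ℕ}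
    (h : ∀ g ∈ G, ∀ u, coeff w (mon K u * g) = 0) {f : MvPolynomial (Fin 4) K}
    (hf : f ∈ Ideal.span G) : coeff w f = 0 := by
  suffices H : ∀ p, coeff w (p * f) = 0 by simpa using H 1
  induction hf using Submodule.span_induction with
  | mem g hg =>
    intro p
    have : (lcoeff K w).comp (LinearMap.mulRight K g) = 0 :=
      linearMap_ext fun u => by simpa [lcoeff_apply] using h g hg u
    simpa [lcoeff_apply] using LinearMap.congr_fun this p
  | zero => simp
  | add x y _ _ hx hy => intro p; rw [mul_add, coeff_add, hx, hy, add_zero]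
  | smul a x _ hx => intro p; rw [smul_eq_mul, ← mul_assoc]; exact hx _

/-- If `x^w` is a term of `x^c (x^a - x^b)` with `c ≠ 0`, the other term is equivalent to it and
shares a variable of `x^c`, against isolation. So `x^w` can only enter the ideal as a term of a
generator itself. -/
lemma IsIsolated.isIndispensableMonomial {w q : Fin 4 →₀ ℕ}
    (hw : IsIsolated n w) (hq : degS n q = degS n w) (hqw : q ≠ w) :
    IsIndispensableMonomial K n w := by
  intro G hG hspan
  by_contra hno
  have hmem : mon K w - mon K q ∈ Ideal.span G := by
    rw [hspan]
    exact mon_sub_mon_mem_toricIdeal.2 hq.symm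
  have hside : ∀ a b c, mon K a - mon K b ∈ G → a ≠ b → c + a ≠ w ∧ c + b ≠ w := by
    intro a b c hg hab
    have hdeg : degS n a = degS n b :=
      mon_sub_mon_mem_toricIdeal.1 (hspan ▸ Ideal.subset_span hg)
    have hs : a ≠ w ∧ b ≠ w := by
      constructor <;> intro h <;> apply hno <;> refine ⟨_, hg, ?_⟩ <;>
        rw [support_mon_sub_mon hab] <;> simp [h]
    by_cases hc : c = 0
    · simpa [hc] using hs
    · obtain ⟨l, hl⟩ := Finsupp.ne_iff.1 hc
      simp only [Finsupp.coe_zero, Pi.zero_apply] at hl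
      constructor
      · intro h
        have := hw (c + b) (by rw [← h, degS_add, degS_add, hdeg])
          (by rw [← h]; intro h2; exact hab (add_left_cancel h2).symm) l
          (by rw [← h, Finsupp.add_apply]; omega)
        rw [Finsupp.add_apply] at this
        omega
      · intro h
        have := hw (c + a) (by rw [← h, degS_add, degS_add, hdeg])
          (by rw [← h]; intro h2; exact hab (add_left_cancel h2)) l
          (by rw [← h, Finsupp.add_apply]; omega)
        rw [Finsupp.add_apply] at this
        omega
  have := coeff_eq_zero_of_mem_span (w := w) (fun g hg c => ?_) hmem
  · rw [coeff_sub, coeff_mon, coeff_mon, if_pos rfl, if_neg hqw, sub_zero] at this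
    exact one_ne_zero this
  · obtain ⟨a, b, hab, rfl⟩ := hG g hg
    obtain ⟨h1, h2⟩ := hside a b c hg hab
    rw [mul_sub, mon_mul, mon_mul, coeff_sub, coeff_mon, coeff_mon, if_neg h1, if_neg h2, sub_zero]

/-! ### The tangent cone as a degeneration of the semigroup ring -/

/-- `x^u` has the largest degree among the monomials of its `𝒮`-degree. -/
def IsTop (n : Fin 4 → ℕ) (u : Fin 4 →₀ ℕ) : Prop :=
  ∀ v, degS n v = degS n u → v.degree ≤ u.degree

/-- Degrees within one `𝒮`-degree are bounded by that `𝒮`-degree, so a maximum exists. -/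
lemma exists_isTop (hn : ∀ i, 0 < n i) (u : Fin 4 →₀ ℕ) :
    ∃ v, degS n v = degS n u ∧ IsTop n v := by
  classical
  let P : ℕ → Prop := fun d => ∃ v, degS n v = degS n u ∧ v.degree = d
  have hb : ∀ d, P d → d ≤ degS n u := by
    rintro _ ⟨v, hv, rfl⟩
    exact hv ▸ degree_le_degS hn v
  have hP : P u.degree := ⟨u, rfl, rfl⟩
  obtain ⟨v, hv, hd⟩ := Nat.findGreatest_spec (hb _ hP) hP
  refine ⟨v, hv, fun w hw => ?_⟩
  have hw' : P w.degree := ⟨w, hw.trans hv, rfl⟩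
  rw [hd]
  exact Nat.le_findGreatest (hb _ hw') hw'

lemma IsTop.degree_eq {u v : Fin 4 →₀ ℕ} (hu : IsTop n u) (hv : IsTop n v)
    (h : degS n u = degS n v) : u.degree = v.degree :=
  le_antisymm (hv u h) (hu v h.symm)

lemma IsTop.congr {u v : Fin 4 →₀ ℕ} (hu : IsTop n u) (h : degS n u = degS n v)
    (hd : u.degree = v.degree) : IsTop n v := fun w hw => hd ▸ hu w (hw.trans h.symm)

lemma IsTop.of_add {u v : Fin 4 →₀ ℕ} (h : IsTop n (u + v)) : IsTop n v := by
  intro w hw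
  have := h (u + w) (by rw [degS_add, degS_add, hw])
  rw [map_add, map_add] at this
  omega

open Classical in
/-- The linear map `x^u ↦ t ^ deg_𝒮(u)` if `x^u` has maximal degree, and `x^u ↦ 0` otherwise. -/
noncomputable def topMap (K : Type*) [Field K] (n : Fin 4 → ℕ) :
    MvPolynomial (Fin 4) K →ₗ[K] Polynomial K :=
  (basisMonomials (Fin 4) K).constr K fun u => if IsTop n u then Polynomial.X ^ degS n u else 0

open Classical in
lemma topMap_mon (u : Fin 4 →₀ ℕ) :
    topMap K n (mon K u) = if IsTop n u then Polynomial.X ^ degS n u else 0 := by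
  have : mon K u = basisMonomials (Fin 4) K u := by simp [mon]
  rw [topMap, this, Module.Basis.constr_basis]

lemma topMap_mon_of_isTop {u : Fin 4 →₀ ℕ} (h : IsTop n u) :
    topMap K n (mon K u) = Polynomial.X ^ degS n u := by rw [topMap_mon, if_pos h]

lemma topMap_mon_of_not_isTop {u : Fin 4 →₀ ℕ} (h : ¬ IsTop n u) :
    topMap K n (mon K u) = 0 := by rw [topMap_mon, if_neg h]

/-- For top `u`, whether `w + u` is top depends only on the `𝒮`-degree of `u`, because top monomials
of equal `𝒮`-degree have equal degree. Multiplication by `x^w` thus descends to the image of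
`topMap`, which makes its kernel an ideal. -/
lemma exists_topMap_mon_mul (w : Fin 4 →₀ ℕ) :
    ∃ T : Polynomial K →ₗ[K] Polynomial K, ∀ f, topMap K n (mon K w * f) = T (topMap K n f) := by
  classical
  let T : Polynomial K →ₗ[K] Polynomial K := (Polynomial.basisMonomials K).constr K fun s =>
    if ∃ u, degS n u = s ∧ IsTop n u ∧ IsTop n (w + u) then Polynomial.X ^ (degS n w + s) else 0
  refine ⟨T, fun f => ?_⟩
  suffices (topMap K n).comp (LinearMap.mulLeft K (mon K w)) = T.comp (topMap K n) from
    LinearMap.congr_fun this f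
  refine linearMap_ext fun u => ?_
  simp only [LinearMap.comp_apply, LinearMap.mulLeft_apply, mon_mul]
  by_cases hu : IsTop n u
  · have hX : (Polynomial.X : Polynomial K) ^ degS n u =
        Polynomial.basisMonomials K (degS n u) := by simp [Polynomial.X_pow_eq_monomial]
    rw [topMap_mon_of_isTop hu, hX, Module.Basis.constr_basis, topMap_mon, degS_add]
    congr 1
    refine propext ⟨fun h => ⟨u, rfl, hu, h⟩, ?_⟩
    rintro ⟨v, hv, htv, hwv⟩
    refine hwv.congr (by rw [degS_add, degS_add, hv]) ?_
    rw [map_add, map_add, htv.degree_eq hu hv]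
  · rw [topMap_mon_of_not_isTop hu, topMap_mon_of_not_isTop fun h => hu h.of_add, map_zero]

lemma topMap_mul_eq_zero {f : MvPolynomial (Fin 4) K} (hf : topMap K n f = 0)
    (p : MvPolynomial (Fin 4) K) : topMap K n (p * f) = 0 := by
  have : (topMap K n).comp (LinearMap.mulRight K f) = 0 := linearMap_ext fun u => by
    obtain ⟨T, hT⟩ := exists_topMap_mon_mul (K := K) (n := n) u
    simp [hT, hf]
  simpa using LinearMap.congr_fun this p

open Classical in
lemma coeff_topMap (f : MvPolynomial (Fin 4) K) (s : ℕ) :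
    (topMap K n f).coeff s = ∑ u ∈ f.support, if IsTop n u ∧ degS n u = s then coeff u f else 0 := by
  conv_lhs => rw [f.as_sum, map_sum, Polynomial.finsetSum_coeff]
  refine Finset.sum_congr rfl fun u _ => ?_
  have : monomial u (coeff u f) = coeff u f • mon K u := by simp [mon, smul_monomial]
  rw [this, map_smul, topMap_mon, Polynomial.coeff_smul]
  by_cases hu : IsTop n u <;> simp [hu, Polynomial.coeff_X_pow, eq_comm]

lemma coeff_eq_zero_of_degree_lt {f : MvPolynomial (Fin 4) K} {u : Fin 4 →₀ ℕ}
    (h : u.degree < sInf {d : ℕ | homogeneousComponent d f ≠ 0}) : coeff u f = 0 := by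
  have h1 : homogeneousComponent u.degree f = 0 := by
    by_contra h2
    exact Nat.notMem_of_lt_sInf h h2
  have := coeff_homogeneousComponent u.degree f u
  rwa [h1, if_pos rfl, coeff_zero, eq_comm] at this

lemma topMap_leastForm {f : MvPolynomial (Fin 4) K} (hf : f ∈ toricIdeal K n) :
    topMap K n (leastForm K f) = 0 := by
  classical
  ext s
  rw [leastForm]
  set d := sInf {d : ℕ | homogeneousComponent d f ≠ 0} with hd
  rw [coeff_topMap, Polynomial.coeff_zero]
  have hsub : (homogeneousComponent d f).support ⊆ f.support := fun u hu => by
    rw [mem_support_iff, coeff_homogeneousComponent] at hu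
    rw [mem_support_iff]
    exact fun h => hu (by rw [h, ite_self])
  rw [Finset.sum_subset hsub fun u _ hu => by rw [notMem_support_iff.1 hu, ite_self]]
  -- If a top monomial of `𝒮`-degree `s` has the least degree `d` of `f`, every monomial of `f` of
  -- that `𝒮`-degree has degree exactly `d` and is top, so the coefficient is the vanishing sum
  -- `sum_coeff_eq_zero`. Otherwise no term contributes.
  by_cases hex : ∃ u, IsTop n u ∧ degS n u = s ∧ u.degree = d
  · obtain ⟨u, hu, hus, hud⟩ := hex
    have h0 := sum_coeff_eq_zero hf s
    rw [Finset.sum_filter] at h0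
    refine (Finset.sum_congr rfl fun v hv => ?_).trans h0
    by_cases hvs : degS n v = s
    · have h1 : v.degree ≤ d := hud ▸ hu v (hvs.trans hus.symm)
      have h2 : d ≤ v.degree := by
        by_contra hlt
        exact mem_support_iff.1 hv (coeff_eq_zero_of_degree_lt (not_le.1 hlt))
      have h3 : v.degree = d := le_antisymm h1 h2
      rw [if_pos ⟨hu.congr (hus.trans hvs.symm) (hud.trans h3.symm), hvs⟩, if_pos hvs,
        coeff_homogeneousComponent, if_pos h3]
    · rw [if_neg hvs, if_neg fun h => hvs h.2]
  · refine Finset.sum_eq_zero fun v _ => ?_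
    split_ifs with hv
    · rw [coeff_homogeneousComponent, if_neg fun h => hex ⟨v, hv.1, hv.2, h⟩]
    · rfl

lemma homogeneousComponent_mon (d : ℕ) (u : Fin 4 →₀ ℕ) :
    homogeneousComponent d (mon K u) = if u.degree = d then mon K u else 0 := by
  ext v
  rw [coeff_homogeneousComponent, coeff_mon]
  by_cases huv : u = v
  · subst huv
    by_cases hd : u.degree = d <;> simp [coeff_mon, hd]
  · split_ifs <;> simp [coeff_mon, huv]

lemma leastForm_mon_sub_mon {u v : Fin 4 →₀ ℕ} (h : u.degree < v.degree) :
    leastForm K (mon K u - mon K v) = mon K u := by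
  have hcomp : ∀ d, homogeneousComponent d (mon K u - mon K v) =
      (if u.degree = d then mon K u else 0) - if v.degree = d then mon K v else 0 := fun d => by
    rw [map_sub, homogeneousComponent_mon, homogeneousComponent_mon]
  have hu : homogeneousComponent u.degree (mon K u - mon K v) = mon K u := by
    rw [hcomp, if_pos rfl, if_neg (by omega), sub_zero]
  have : sInf {d : ℕ | homogeneousComponent d (mon K u - mon K v) ≠ 0} = u.degree := by
    refine le_antisymm (Nat.sInf_le ?_) (le_csInf ⟨u.degree, ?_⟩ fun d hd => ?_)
    · rw [Set.mem_ofPred_eq, hu]; simp [mon]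
    · rw [Set.mem_ofPred_eq, hu]; simp [mon]
    · by_contra hlt
      exact hd (by rw [hcomp, if_neg (by omega), if_neg (by omega), sub_zero])
  rw [leastForm, this, hu]

lemma leastForm_mon_sub_mon_of_eq {u v : Fin 4 →₀ ℕ} (h : u.degree = v.degree) :
    leastForm K (mon K u - mon K v) = mon K u - mon K v := by
  by_cases huv : u = v
  · subst huv
    simp [leastForm]
  have hcomp : ∀ d, homogeneousComponent d (mon K u - mon K v) =
      if u.degree = d then mon K u - mon K v else 0 := fun d => by
    rw [map_sub, homogeneousComponent_mon, homogeneousComponent_mon, ← h]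
    split_ifs <;> simp
  have hne : mon K u - mon K v ≠ 0 := fun h => huv (mon_injective (sub_eq_zero.1 h))
  have : sInf {d : ℕ | homogeneousComponent d (mon K u - mon K v) ≠ 0} = u.degree := by
    have : {d : ℕ | homogeneousComponent d (mon K u - mon K v) ≠ 0} = {u.degree} := by
      ext d
      rw [Set.mem_ofPred_eq, hcomp, Set.mem_singleton_iff]
      split_ifs with hd
      · simp [hne, hd]
      · simpa using Ne.symm hd
    rw [this, csInf_singleton]
  rw [leastForm, this, hcomp, if_pos rfl]

/-- The ideal of least forms of `I(C)` is the kernel of `topMap`. -/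
lemma mem_leastFormIdeal {f : MvPolynomial (Fin 4) K} :
    f ∈ leastFormIdeal K (toricIdeal K n) ↔ topMap K n f = 0 := by
  classical
  constructor
  · intro hf
    rw [leastFormIdeal] at hf
    induction hf using Submodule.span_induction with
    | mem x hx =>
      obtain ⟨g, hg, rfl⟩ := hx
      exact topMap_leastForm hg
    | zero => exact map_zero _
    | add x y _ _ hx hy => rw [map_add, hx, hy, add_zero]
    | smul a x _ hx => exact topMap_mul_eq_zero hx a
  · intro hf
    -- A section of `topMap` choosing a top monomial in each `𝒮`-degree. A top `x^u` differs from
    -- its representative by a homogeneous binomial of `I(C)`; a non-top one is itself the least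
    -- form of a binomial.
    let c : ℕ → (Fin 4 →₀ ℕ) := fun s =>
      if hs : ∃ u, degS n u = s ∧ IsTop n u then hs.choose else 0
    refine mem_of_map_eq_zero (topMap K n)
      ((Polynomial.basisMonomials K).constr K fun s => mon K (c s)) _ (fun u => ?_) hf
    by_cases hu : IsTop n u
    · have hX : (Polynomial.X : Polynomial K) ^ degS n u =
          Polynomial.basisMonomials K (degS n u) := by simp [Polynomial.X_pow_eq_monomial]
      rw [topMap_mon_of_isTop hu, hX, Module.Basis.constr_basis]
      have hs : ∃ v, degS n v = degS n u ∧ IsTop n v := ⟨u, rfl, hu⟩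
      have hc : degS n (c (degS n u)) = degS n u ∧ IsTop n (c (degS n u)) := by
        simp only [c, dif_pos hs]
        exact hs.choose_spec
      exact Ideal.subset_span ⟨_, mon_sub_mon_mem_toricIdeal.2 hc.1.symm,
        leastForm_mon_sub_mon_of_eq (hu.degree_eq hc.2 hc.1.symm)⟩
    · rw [topMap_mon_of_not_isTop hu, map_zero, sub_zero]
      simp only [IsTop, not_forall, not_le] at hu
      obtain ⟨v, hv, hlt⟩ := hu
      exact Ideal.subset_span ⟨_, mon_sub_mon_mem_toricIdeal.2 hv.symm, leastForm_mon_sub_mon hlt⟩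

/-! ### Cohen–Macaulayness of the tangent cone -/

/-- The coordinate ring of the tangent cone. -/
abbrev TangentCone (K : Type*) [Field K] (n : Fin 4 → ℕ) : Type _ :=
  MvPolynomial (Fin 4) K ⧸ leastFormIdeal K (toricIdeal K n)

/-- The class of a polynomial in the coordinate ring of the tangent cone. -/
noncomputable abbrev toCone (K : Type*) [Field K] (n : Fin 4 → ℕ) :
    MvPolynomial (Fin 4) K →+* TangentCone K n :=
  Ideal.Quotient.mk (leastFormIdeal K (toricIdeal K n))

lemma toCone_eq_zero {f : MvPolynomial (Fin 4) K} :
    toCone K n f = 0 ↔ topMap K n f = 0 := by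
  rw [Ideal.Quotient.eq_zero_iff_mem, mem_leastFormIdeal]

/-! ### The tangent cone as a thickening of the `x₀`-axis. -/

lemma degS_eq_sub_add (u : Fin 4 →₀ ℕ) (h0 : ∀ l, n 0 ≤ n l) :
    degS n u = u.degree * n 0 + ∑ l, u l * (n l - n 0) := by
  rw [degS, Finsupp.degree_eq_sum, Finset.sum_mul, ← Finset.sum_add_distrib]
  exact Finset.sum_congr rfl fun l _ => by rw [← mul_add, Nat.add_sub_cancel' (h0 l)]

lemma isTop_single_zero (hpos : 0 < n 0) (hmono : StrictMono n) (c : ℕ) :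
    IsTop n (Finsupp.single 0 c) := by
  intro v hv
  rw [degS_eq_sub_add v (fun l => hmono.monotone (Fin.zero_le l)), degS_single] at hv
  rw [Finsupp.degree_single]
  exact Nat.le_of_mul_le_mul_right (by omega) hpos

/-- Comparison with the power of `x₀` of the same `𝒮`-degree: since `n₀` is strictly smallest, any
other variable would make the degree strictly smaller. -/
lemma IsTop.eq_single_of_dvd (hmono : StrictMono n) {u : Fin 4 →₀ ℕ}
    (hu : IsTop n u) (hdvd : n 0 ∣ degS n u) : u = Finsupp.single 0 u.degree := by
  obtain ⟨c, hc⟩ := hdvd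
  have h1 := hu (Finsupp.single 0 c) (by rw [degS_single, hc, mul_comm])
  rw [Finsupp.degree_single] at h1
  rw [degS_eq_sub_add u (fun l => hmono.monotone (Fin.zero_le l))] at hc
  have h2 : ∑ l, u l * (n l - n 0) = 0 := by
    have : n 0 * c ≤ u.degree * n 0 := by rw [mul_comm]; exact Nat.mul_le_mul_right _ h1
    omega
  have h3 : ∀ l, l ≠ 0 → u l = 0 := fun l hl => by
    have := (Finset.sum_eq_zero_iff.1 h2) l (Finset.mem_univ l)
    have hlt : n 0 < n l := hmono (Fin.pos_of_ne_zero hl)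
    rcases Nat.mul_eq_zero.1 this with h | h
    · exact h
    · omega
  have h4 : u = Finsupp.single 0 (u 0) := by
    ext l
    by_cases hl : l = 0
    · subst hl; simp
    · rw [h3 l hl, Finsupp.single_eq_of_ne hl]
  conv_rhs => rw [h4, Finsupp.degree_single]
  exact h4

/-- The substitution `x₀ ↦ X`, `xₗ ↦ 0` for `l ≠ 0`. -/
noncomputable def toLine (K : Type*) [Field K] :
    MvPolynomial (Fin 4) K →ₐ[K] Polynomial K :=
  aeval fun l => if l = 0 then Polynomial.X else 0

lemma toLine_mon_single (c : ℕ) : toLine K (mon K (Finsupp.single 0 c)) = Polynomial.X ^ c := by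
  rw [← X_pow_eq_mon, map_pow, toLine, aeval_X, if_pos rfl]

lemma toLine_mon_of_ne {u : Fin 4 →₀ ℕ} {l : Fin 4} (hl : l ≠ 0) (hu : u l ≠ 0) :
    toLine K (mon K u) = 0 := by
  obtain ⟨v, rfl⟩ : ∃ v, u = Finsupp.single l 1 + v :=
    exists_add_of_le (Finsupp.single_le_iff.2 (Nat.one_le_iff_ne_zero.2 hu))
  rw [← mon_mul, ← X_eq_mon, map_mul, toLine, aeval_X, if_neg hl, zero_mul]

lemma toLine_eq_zero (hpos : 0 < n 0) (hmono : StrictMono n) {f : MvPolynomial (Fin 4) K}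
    (hf : topMap K n f = 0) : toLine K f = 0 := by
  classical
  -- `toLine` factors through `topMap`, because the only top monomials of `𝒮`-degree divisible by
  -- `n₀` are the powers of `x₀`.
  let E : Polynomial K →ₗ[K] Polynomial K := (Polynomial.basisMonomials K).constr K fun s =>
    if n 0 ∣ s then Polynomial.X ^ (s / n 0) else 0
  suffices (toLine K).toLinearMap = E.comp (topMap K n) by
    simpa [hf] using LinearMap.congr_fun this f
  refine linearMap_ext fun u => ?_
  rw [AlgHom.toLinearMap_apply, LinearMap.comp_apply]
  have hX : (Polynomial.X : Polynomial K) ^ degS n u =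
      Polynomial.basisMonomials K (degS n u) := by simp [Polynomial.X_pow_eq_monomial]
  by_cases hu : ∃ l, l ≠ 0 ∧ u l ≠ 0
  · obtain ⟨l, hl, hul⟩ := hu
    rw [toLine_mon_of_ne hl hul]
    by_cases ht : IsTop n u
    · rw [topMap_mon_of_isTop ht, hX, Module.Basis.constr_basis, if_neg]
      intro hdvd
      rw [ht.eq_single_of_dvd hmono hdvd, Finsupp.single_eq_of_ne hl] at hul
      exact hul rfl
    · rw [topMap_mon_of_not_isTop ht, map_zero]
  · push Not at hu
    have h4 : u = Finsupp.single 0 (u 0) := by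
      ext l
      by_cases hl : l = 0
      · subst hl; simp
      · rw [hu l hl, Finsupp.single_eq_of_ne hl]
    have ht : IsTop n u := h4 ▸ isTop_single_zero hpos hmono (u 0)
    rw [topMap_mon_of_isTop ht, hX, Module.Basis.constr_basis, h4, toLine_mon_single, degS_single,
      if_pos (Dvd.intro_left _ rfl), Nat.mul_div_cancel _ hpos]

/-- The projection of the tangent cone to the `x₀`-axis. -/
noncomputable def coneToLine (hpos : 0 < n 0) (hmono : StrictMono n) :
    TangentCone K n →+* Polynomial K :=
  Ideal.Quotient.lift _ (toLine K : MvPolynomial (Fin 4) K →+* Polynomial K) fun _ hf =>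
    toLine_eq_zero hpos hmono (mem_leastFormIdeal.1 hf)

lemma coneToLine_toCone (hpos : 0 < n 0) (hmono : StrictMono n) (f : MvPolynomial (Fin 4) K) :
    coneToLine hpos hmono (toCone K n f) = toLine K f := rfl

/-- The inclusion of the polynomials in `x₀`. -/
noncomputable def lineIncl (K : Type*) [Field K] : Polynomial K →ₐ[K] MvPolynomial (Fin 4) K :=
  Polynomial.aeval (X 0)

lemma toLine_lineIncl (p : Polynomial K) : toLine K (lineIncl K p) = p := by
  have : (toLine K).comp (lineIncl K) = AlgHom.id K _ := by
    ext
    simp [toLine, lineIncl]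
  exact DFunLike.congr_fun this p

/-- `x_l ^ n₀` is equivalent to `x₀ ^ n_l`, which has larger degree, so it is not top. -/
lemma toCone_X_pow_eq_zero (hmono : StrictMono n) {l : Fin 4} (hl : l ≠ 0) :
    toCone K n (X l) ^ n 0 = 0 := by
  rw [← map_pow, toCone_eq_zero, X_pow_eq_mon, topMap_mon_of_not_isTop]
  intro h
  have := h (Finsupp.single 0 (n l)) (by rw [degS_single, degS_single, mul_comm])
  rw [Finsupp.degree_single, Finsupp.degree_single] at this
  have := hmono (Fin.pos_of_ne_zero hl)
  omega

/-- Modulo the nilradical every `x_l` with `l ≠ 0` vanishes, so each class equals that of its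
restriction to the `x₀`-axis. -/
lemma isNilpotent_of_coneToLine_eq_zero (hpos : 0 < n 0) (hmono : StrictMono n)
    {a : TangentCone K n} (ha : coneToLine hpos hmono a = 0) : IsNilpotent a := by
  have hmem : ∀ f : MvPolynomial (Fin 4) K,
      toCone K n (f - lineIncl K (toLine K f)) ∈ nilradical (TangentCone K n) := by
    intro f
    have hhom : ((Ideal.Quotient.mkₐ K (nilradical (TangentCone K n))).comp
        (Ideal.Quotient.mkₐ K (leastFormIdeal K (toricIdeal K n)))) =
        ((Ideal.Quotient.mkₐ K (nilradical (TangentCone K n))).comp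
        (Ideal.Quotient.mkₐ K (leastFormIdeal K (toricIdeal K n)))).comp
          ((lineIncl K).comp (toLine K)) := by
      ext l
      by_cases hl : l = 0
      · subst hl
        simp [toLine, lineIncl]
      · have : Ideal.Quotient.mk (nilradical (TangentCone K n)) (toCone K n (X l)) = 0 := by
          rw [Ideal.Quotient.eq_zero_iff_mem, mem_nilradical]
          exact ⟨n 0, toCone_X_pow_eq_zero hmono hl⟩
        simpa [toLine, lineIncl, hl] using this
    have := DFunLike.congr_fun hhom f
    rw [map_sub, ← Ideal.Quotient.eq]
    exact this
  obtain ⟨f, rfl⟩ := Ideal.Quotient.mk_surjective a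
  have h0 : toLine K f = 0 := ha
  have := hmem f
  rwa [h0, map_zero, sub_zero, mem_nilradical] at this

lemma coneToLine_surjective (hpos : 0 < n 0) (hmono : StrictMono n) :
    Function.Surjective (coneToLine (K := K) hpos hmono) := fun p =>
  ⟨toCone K n (lineIncl K p), by rw [coneToLine_toCone, toLine_lineIncl]⟩

lemma ker_coneToLine_le (hpos : 0 < n 0) (hmono : StrictMono n) (q : Ideal (TangentCone K n))
    [q.IsPrime] : RingHom.ker (coneToLine (K := K) hpos hmono) ≤ q := fun _ ha =>
  nilradical_le_prime q (isNilpotent_of_coneToLine_eq_zero hpos hmono ha)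

/-- Every maximal ideal of the tangent cone is minimal over the ideal of a polynomial in `x₀`. -/
lemma exists_mem_minimalPrimes (hpos : 0 < n 0) (hmono : StrictMono n)
    (m : Ideal (TangentCone K n)) [m.IsMaximal] :
    ∃ p : Polynomial K, p ≠ 0 ∧
      m ∈ (Ideal.span {toCone K n (lineIncl K p)}).minimalPrimes := by
  let π := coneToLine (K := K) hpos hmono
  have hπ : Function.Surjective π := coneToLine_surjective hpos hmono
  obtain ⟨p, hp⟩ := IsPrincipalIdealRing.principal (m.map π)
  have hcomap : (m.map π).comap π = m := by
    rw [Ideal.comap_map_of_surjective' π hπ]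
    exact sup_eq_left.2 (ker_coneToLine_le hpos hmono m)
  have hmax : (m.map π).IsMaximal := by
    refine Or.resolve_right (Ideal.map_eq_top_or_isMaximal_of_surjective π hπ ‹_›).symm ?_
    intro h
    rw [h, Ideal.comap_top] at hcomap
    exact Ideal.IsMaximal.ne_top ‹_› hcomap.symm
  have hp0 : p ≠ 0 := by
    rintro rfl
    rw [hp] at hmax
    simp only [Submodule.span_zero_singleton] at hmax
    exact Polynomial.not_isField K (Ring.isField_iff_maximal_bot.2 hmax)
  have hpm : toCone K n (lineIncl K p) ∈ m := by
    rw [← hcomap, Ideal.mem_comap]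
    change coneToLine hpos hmono _ ∈ _
    rw [coneToLine_toCone, toLine_lineIncl, hp]
    exact Submodule.mem_span_singleton_self p
  refine ⟨p, hp0, ⟨⟨inferInstance, (Ideal.span_singleton_le_iff_mem _).2 hpm⟩, ?_⟩⟩
  -- `π` is surjective with nilpotent kernel, so primes are recovered from their images; the image
  -- of `q` contains the generator `p` of the image of `m`.
  rintro q ⟨hq, hpq⟩ -
  rw [Ideal.span_singleton_le_iff_mem] at hpq
  have hcq : (q.map π).comap π = q := by
    rw [Ideal.comap_map_of_surjective' π hπ]
    exact sup_eq_left.2 (ker_coneToLine_le hpos hmono q)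
  rw [← hcq, ← hcomap]
  refine Ideal.comap_mono ?_
  rw [hp]
  refine (Ideal.span_singleton_le_iff_mem _).2 ?_
  have := Ideal.mem_map_of_mem π hpq
  change coneToLine hpos hmono _ ∈ _ at this
  rwa [coneToLine_toCone, toLine_lineIncl] at this

/-- Krull's principal ideal theorem bounds the height by 1; it is not 0, since the kernel of the
projection to the line is a prime strictly inside `m`. -/
lemma ringKrullDim_localization (hpos : 0 < n 0) (hmono : StrictMono n)
    (m : Ideal (TangentCone K n)) [m.IsMaximal] :
    ringKrullDim (Localization.AtPrime m) = 1 := by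
  refine (IsLocalization.AtPrime.ringKrullDim_eq_height m (Localization.AtPrime m)).trans ?_
  obtain ⟨p, hp, hmin⟩ := exists_mem_minimalPrimes hpos hmono m
  have h1 : m.height ≤ 1 := by
    have : Submodule.IsPrincipal (Ideal.span {toCone K n (lineIncl K p)}) := ⟨_, rfl⟩
    exact Ideal.height_le_one_of_isPrincipal_of_mem_minimalPrimes _ m hmin
  have h2 : m.height ≠ 0 := by
    rw [Ne, Ideal.height_eq_zero_iff]
    intro hm
    have hker : (RingHom.ker (coneToLine (K := K) hpos hmono)).IsPrime := RingHom.ker_isPrime _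
    have := hm.2 ⟨hker, bot_le⟩ (ker_coneToLine_le hpos hmono m)
    have hz : toCone K n (lineIncl K p) ∈ RingHom.ker (coneToLine (K := K) hpos hmono) :=
      this ((Ideal.span_singleton_le_iff_mem _).1 hmin.1.2)
    rw [RingHom.mem_ker, coneToLine_toCone, toLine_lineIncl] at hz
    exact hp hz
  have h3 : m.height = 1 := le_antisymm h1 (Order.one_le_iff_ne_zero.2 h2)
  rw [h3]
  rfl

/-- If multiplication by `x₀` preserves maximality of the degree, the tangent cone has no torsion
over the polynomials in `x₀`. -/
lemma toCone_lineIncl_mul_eq_zero (hpos : 0 < n 0)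
    (h : ∀ u, IsTop n u → IsTop n (Finsupp.single 0 1 + u)) {p : Polynomial K} (hp : p ≠ 0)
    {a : TangentCone K n} (ha : toCone K n (lineIncl K p) * a = 0) : a = 0 := by
  obtain ⟨f, rfl⟩ := Ideal.Quotient.mk_surjective a
  -- Under `topMap`, multiplication by `x₀` becomes multiplication by `t ^ n₀`, hence `p(x₀)` acts
  -- as the nonzero polynomial `p(t ^ n₀)` in the domain `K[t]`.
  have hX : ∀ f, topMap K n (X 0 * f) = Polynomial.X ^ n 0 * topMap K n f := by
    intro f
    have : (topMap K n).comp (LinearMap.mulLeft K (X 0)) =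
        (LinearMap.mulLeft K (Polynomial.X ^ n 0)).comp (topMap K n) := by
      refine linearMap_ext fun u => ?_
      simp only [LinearMap.comp_apply, LinearMap.mulLeft_apply, X_eq_mon, mon_mul]
      by_cases hu : IsTop n u
      · rw [topMap_mon_of_isTop hu, topMap_mon_of_isTop (h u hu), degS_add, degS_single, one_mul,
          pow_add]
      · rw [topMap_mon_of_not_isTop hu, topMap_mon_of_not_isTop fun h => hu h.of_add, mul_zero]
    exact LinearMap.congr_fun this f
  have hpow : ∀ (c : ℕ) f,
      topMap K n (X 0 ^ c * f) = (Polynomial.X ^ n 0) ^ c * topMap K n f := by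
    intro c
    induction c with
    | zero => simp
    | succ c ih => intro f; rw [pow_succ, mul_assoc, ih, hX, ← mul_assoc, ← pow_succ]
  have hmul : ∀ q, topMap K n (lineIncl K q * f) =
      Polynomial.expand K (n 0) q * topMap K n f := by
    intro q
    induction q using Polynomial.induction_on' with
    | add q r hq hr => rw [map_add, add_mul, map_add, hq, hr, map_add, add_mul]
    | monomial c a =>
      rw [← Polynomial.smul_X_eq_monomial, map_smul, map_smul, smul_mul_assoc, smul_mul_assoc,
        map_smul, map_pow, map_pow, Polynomial.expand_X, lineIncl, Polynomial.aeval_X, hpow]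
  change toCone K n _ * toCone K n f = 0 at ha
  change toCone K n f = 0
  rw [← map_mul, toCone_eq_zero, hmul] at ha
  rw [toCone_eq_zero]
  exact (mul_eq_zero.1 ha).resolve_left ((Polynomial.expand_ne_zero hpos).2 hp)

/-! ### Regular elements and the Cohen–Macaulay criterion. -/

lemma isRegular_singleton_iff {R : Type*} [CommRing R] [IsLocalRing R] {r : R}
    (hr : r ∈ IsLocalRing.maximalIdeal R) :
    RingTheory.Sequence.IsRegular R [r] ↔ ∀ b, r * b = 0 → b = 0 := by
  rw [IsLocalRing.isRegular_iff_isWeaklyRegular_of_subset_maximalIdeal (by simpa using hr),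
    RingTheory.Sequence.isWeaklyRegular_singleton_iff]
  exact isSMulRegular_iff_right_eq_zero_of_smul

/-- The ideal of the vertex of the tangent cone. -/
noncomputable def vertexHom (hpos : 0 < n 0) (hmono : StrictMono n) : TangentCone K n →+* K :=
  Polynomial.constantCoeff.comp (coneToLine hpos hmono)

/-- Nonconstant monomials strictly raise the `𝒮`-degree. Consequently a polynomial with nonzero
constant term cannot annihilate a top monomial in the tangent cone, and such a monomial survives
localization at the vertex. -/
lemma coeff_topMap_mul_mon (hn : ∀ i, 0 < n i) {u : Fin 4 →₀ ℕ} (hu : IsTop n u)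
    (f : MvPolynomial (Fin 4) K) :
    (topMap K n (f * mon K u)).coeff (degS n u) = constantCoeff f := by
  have : (Polynomial.lcoeff K (degS n u)).comp
      ((topMap K n).comp (LinearMap.mulRight K (mon K u))) = lcoeff K 0 := by
    refine linearMap_ext fun w => ?_
    simp only [LinearMap.comp_apply, LinearMap.mulRight_apply, mon_mul, Polynomial.lcoeff_apply,
      lcoeff_apply, coeff_mon]
    by_cases hw : w = 0
    · rw [hw, zero_add, topMap_mon_of_isTop hu, if_pos rfl, Polynomial.coeff_X_pow_self]
    · have hw' : degS n w ≠ 0 := fun h => hw (eq_zero_of_degS_eq_zero hn h)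
      rw [if_neg hw, topMap_mon]
      split_ifs
      · rw [degS_add, Polynomial.coeff_X_pow, if_neg (by omega)]
      · rw [Polynomial.coeff_zero]
  exact LinearMap.congr_fun this f

lemma vertexHom_toCone (hpos : 0 < n 0) (hmono : StrictMono n) (f : MvPolynomial (Fin 4) K) :
    vertexHom hpos hmono (toCone K n f) = constantCoeff f := by
  have : Polynomial.constantCoeff.comp (toLine K : MvPolynomial (Fin 4) K →+* Polynomial K) =
      constantCoeff := by
    ext l
    · simp
    · by_cases hl : l = 0 <;> simp [toLine, hl]
  exact DFunLike.congr_fun this f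

/-- If `x^u` is top but `x₀ x^u` is not, `x₀` kills `x^u` in the cone. At the vertex a regular
element has a power in `(x₀)`, so it would force `x^u` to vanish locally. Conversely, if topness is
preserved, the cone is torsion-free over `K[x₀]`, and the `p(x₀)` over which a maximal ideal is
minimal is a regular sequence of length 1, also after the flat localization. -/
theorem hasCohenMacaulayTangentCone_iff (hpos : 0 < n 0) (hmono : StrictMono n) :
    HasCohenMacaulayTangentCone K n ↔ ∀ u, IsTop n u → IsTop n (Finsupp.single 0 1 + u) := by
  have hn : ∀ i, 0 < n i := fun i => hpos.trans_le (hmono.monotone (Fin.zero_le i))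
  constructor
  · rintro ⟨-, hCM⟩
    by_contra hcon
    push Not at hcon
    obtain ⟨u, hu, hu'⟩ := hcon
    let v := vertexHom (K := K) hpos hmono
    have hv : Function.Surjective v := fun a =>
      ⟨toCone K n (C a), by rw [vertexHom_toCone, constantCoeff_C]⟩
    have hmax : (RingHom.ker v).IsMaximal := RingHom.ker_isMaximal_of_surjective v hv
    let m := RingHom.ker v
    obtain ⟨-, rs, hrs, hreg, hdim⟩ := hCM m
    rw [ringKrullDim_localization hpos hmono m] at hdim
    have hlen : rs.length = 1 := by exact_mod_cast hdim.symm
    obtain ⟨r, rfl⟩ := List.length_eq_one_iff.1 hlen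
    have hr := hrs r (by simp)
    rw [isRegular_singleton_iff hr] at hreg
    let φ := algebraMap (TangentCone K n) (Localization.AtPrime m)
    have hrad : m ≤ (Ideal.span {toCone K n (X 0)}).radical := by
      intro a ha
      obtain ⟨q, hq⟩ : Polynomial.X ∣ coneToLine hpos hmono a := Polynomial.X_dvd_iff.2 ha
      have hnil : IsNilpotent (a - toCone K n (X 0) * toCone K n (lineIncl K q)) := by
        refine isNilpotent_of_coneToLine_eq_zero hpos hmono ?_
        rw [map_sub, map_mul, coneToLine_toCone, coneToLine_toCone, toLine_lineIncl, hq, toLine,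
          aeval_X, if_pos rfl, sub_self]
      rw [← sub_add_cancel a (toCone K n (X 0) * toCone K n (lineIncl K q))]
      refine add_mem (Ideal.radical_mono bot_le hnil) (Ideal.le_radical ?_)
      exact Ideal.mul_mem_right _ _ (Ideal.mem_span_singleton_self _)
    obtain ⟨c, hc⟩ : ∃ c, r ^ c ∈ Ideal.span {φ (toCone K n (X 0))} := by
      rw [← Localization.AtPrime.map_eq_maximalIdeal] at hr
      have := Ideal.map_radical_le φ (Ideal.map_mono hrad hr)
      rwa [Ideal.map_span, Set.image_singleton] at this
    obtain ⟨b, hb⟩ := Ideal.mem_span_singleton'.1 hc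
    have hzero : φ (toCone K n (X 0)) * φ (toCone K n (mon K u)) = 0 := by
      rw [← map_mul, ← map_mul, X_eq_mon, mon_mul,
        toCone_eq_zero.2 (topMap_mon_of_not_isTop hu'), map_zero]
    have hpow : ∀ c y, r ^ c * y = 0 → y = 0 := by
      intro c
      induction c with
      | zero => simp
      | succ c ih => intro y hy; exact hreg _ (ih _ (by rw [← mul_assoc, ← pow_succ, hy]))
    have h0 : φ (toCone K n (mon K u)) = 0 :=
      hpow c _ (by rw [← hb, mul_assoc, hzero, mul_zero])
    obtain ⟨⟨s, hs⟩, hsu⟩ :=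
      (IsLocalization.map_eq_zero_iff m.primeCompl (Localization.AtPrime m) _).1 h0
    obtain ⟨f, rfl⟩ := Ideal.Quotient.mk_surjective s
    change toCone K n f * toCone K n (mon K u) = 0 at hsu
    rw [← map_mul, toCone_eq_zero] at hsu
    have h1 := coeff_topMap_mul_mon hn hu f
    rw [hsu, Polynomial.coeff_zero] at h1
    apply hs
    change v (toCone K n f) = 0
    rw [vertexHom_toCone, ← h1]
  · intro h
    refine ⟨inferInstance, fun m _ => ⟨inferInstance, ?_⟩⟩
    obtain ⟨p, hp, hmin⟩ := exists_mem_minimalPrimes hpos hmono m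
    let φ := algebraMap (TangentCone K n) (Localization.AtPrime m)
    have hmem : φ (toCone K n (lineIncl K p)) ∈
        IsLocalRing.maximalIdeal (Localization.AtPrime m) :=
      (IsLocalization.AtPrime.to_map_mem_maximal_iff _ m _).2
        ((Ideal.span_singleton_le_iff_mem _).1 hmin.1.2)
    refine ⟨[φ (toCone K n (lineIncl K p))], by simpa using hmem, ?_, ?_⟩
    · rw [isRegular_singleton_iff hmem]
      have : IsSMulRegular (TangentCone K n) (toCone K n (lineIncl K p)) := by
        rw [isSMulRegular_iff_right_eq_zero_of_smul]
        exact fun a ha => toCone_lineIncl_mul_eq_zero hpos h hp ha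
      have := IsSMulRegular.of_flat (S := Localization.AtPrime m) this
      exact fun b hb => this (show φ _ * b = φ _ * 0 by rw [hb, mul_zero])
    · rw [ringKrullDim_localization hpos hmono m]
      simp

/-! ### Arithmetic of the critical exponents in case 2(b) -/

/-- The numerical properties of the critical exponents `a` of a curve of case 2(b). -/
structure NumCase (n0 ni nj nk a0 ai aj ak : ℕ) : Prop where
  h0 : a0 * n0 = ai * ni
  hj : aj * nj = ak * nk
  pi : 0 < ni
  pj : 0 < nj
  pk : 0 < nk
  p0 : 0 < n0
  q0 : 0 < a0
  c0 : ∀ c x y z, 0 < c → c * n0 = x * ni + y * nj + z * nk → a0 ≤ c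
  ci : ∀ c x y z, 0 < c → c * ni = x * n0 + y * nj + z * nk → ai ≤ c
  cj : ∀ c x y z, 0 < c → c * nj = x * n0 + y * ni + z * nk → aj ≤ c
  ck : ∀ c x y z, 0 < c → c * nk = x * n0 + y * ni + z * nj → ak ≤ c

variable {n0 ni nj nk a0 ai aj ak ui uj uk : ℕ}

/-- A bounded monomial in `xᵢ, xⱼ, xₖ` with a coprime equivalent monomial in the same variables is
equivalent only to a power of `xᵢ`. -/
lemma NumCase.eq_pow_of_disjoint (H : NumCase n0 ni nj nk a0 ai aj ak)
    {x y z b c d : ℕ} (hx : x < ai) (hy : y < aj) (hz : z < ak)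
    (hne : x * ni + y * nj + z * nk ≠ 0)
    (hb : x = 0 ∨ b = 0) (hc : y = 0 ∨ c = 0) (hd : z = 0 ∨ d = 0)
    (h : x * ni + y * nj + z * nk = b * ni + c * nj + d * nk) : c = 0 ∧ d = 0 ∧ ai ≤ b := by
  have hj := H.hj
  have hx' : ∀ c d, x * ni = c * nj + d * nk → x = 0 := by
    intro c d h1
    by_contra h3
    have := H.ci x 0 c d (by omega) (by omega)
    omega
  rcases Nat.eq_zero_or_pos x with rfl | hx0 <;> rcases Nat.eq_zero_or_pos y with rfl | hy0 <;>
    rcases Nat.eq_zero_or_pos z with rfl | hz0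
  · simp at hne
  · obtain rfl : d = 0 := by omega
    have := H.ck z 0 b c hz0 (by omega)
    omega
  · obtain rfl : c = 0 := by omega
    have := H.cj y 0 b d hy0 (by omega)
    omega
  · obtain rfl : d = 0 := by omega
    obtain rfl : c = 0 := by omega
    refine ⟨rfl, rfl, ?_⟩
    rcases Nat.eq_zero_or_pos b with rfl | hb0
    · omega
    · exact H.ci b 0 y z hb0 (by omega)
  · obtain rfl : b = 0 := by omega
    have := hx' c d (by omega)
    omega
  · obtain rfl : d = 0 := by omega
    obtain rfl : b = 0 := by omega
    rcases Nat.eq_zero_or_pos c with rfl | hc0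
    · omega
    -- Minimality gives `c ≥ aj`. Trading `aj * nj` for `ak * nk` and cancelling `z < ak` writes `x
    -- * ni` through `nj` and `nk`, impossible for `0 < x < ai`.
    · obtain ⟨e, rfl⟩ := Nat.exists_eq_add_of_le (H.cj c 0 x z hc0 (by omega))
      obtain ⟨f, rfl⟩ := Nat.exists_eq_add_of_lt hz
      have := hx' e (f + 1) (by linarith)
      omega
  · obtain rfl : c = 0 := by omega
    obtain rfl : b = 0 := by omega
    rcases Nat.eq_zero_or_pos d with rfl | hd0
    · omega
    · obtain ⟨e, rfl⟩ := Nat.exists_eq_add_of_le (H.ck d 0 x y hd0 (by omega))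
      obtain ⟨f, rfl⟩ := Nat.exists_eq_add_of_lt hy
      have := hx' (f + 1) e (by linarith)
      omega
  · obtain rfl : d = 0 := by omega
    obtain rfl : c = 0 := by omega
    obtain rfl : b = 0 := by omega
    omega

lemma exists_common_part (x b : ℕ) : ∃ m x' b', x = m + x' ∧ b = m + b' ∧ (x' = 0 ∨ b' = 0) :=
  ⟨min x b, x - min x b, b - min x b, by omega, by omega, by omega⟩

/-- A bounded monomial that shares no variable with an equivalent monomial divisible by `x₀` shares
no variable with any other equivalent monomial. -/
lemma NumCase.isolated (H : NumCase n0 ni nj nk a0 ai aj ak)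
    (hi : ui < ai) (hj : uj < aj) (hk : uk < ak)
    (hmin : ∀ a b c d, 0 < a → a * n0 + b * ni + c * nj + d * nk = ui * ni + uj * nj + uk * nk →
      (0 < ui → b = 0) ∧ (0 < uj → c = 0) ∧ (0 < uk → d = 0))
    {a b c d : ℕ} (h : a * n0 + b * ni + c * nj + d * nk = ui * ni + uj * nj + uk * nk)
    (hne : ¬ (b = ui ∧ c = uj ∧ d = uk)) :
    (0 < ui → b = 0) ∧ (0 < uj → c = 0) ∧ (0 < uk → d = 0) := by
  rcases Nat.eq_zero_or_pos a with rfl | ha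
  · obtain ⟨m, x, b, rfl, rfl, hb⟩ := exists_common_part ui b
    obtain ⟨p, y, c, rfl, rfl, hc⟩ := exists_common_part uj c
    obtain ⟨q, z, d, rfl, rfl, hd⟩ := exists_common_part uk d
    have heq : x * ni + y * nj + z * nk = b * ni + c * nj + d * nk := by linarith
    have hne' : x * ni + y * nj + z * nk ≠ 0 := by
      intro h0
      rw [h0] at heq
      have pi := H.pi
      have pj := H.pj
      have pk := H.pk
      simp only [Nat.add_eq_zero_iff, mul_eq_zero] at h0
      have heq := heq.symm
      simp only [Nat.add_eq_zero_iff, mul_eq_zero] at heq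
      omega
    obtain ⟨rfl, rfl, hb'⟩ := H.eq_pow_of_disjoint (by omega) (by omega) (by omega) hne' hb hc hd heq
    obtain ⟨e, rfl⟩ := Nat.exists_eq_add_of_le hb'
    -- The common part is restored and `xᵢ ^ aᵢ` is traded for `x₀ ^ a₀`, which gives an equivalent
    -- monomial divisible by `x₀`, to which `hmin` applies.
    have := hmin a0 (m + e) p q H.q0 (by have := H.h0; linarith)
    omega
  · exact hmin a b c d ha h

/-- The shapes of the bounded monomials that share no variable with an equivalent monomial divisible
by `x₀`. -/
lemma NumCase.cases (H : NumCase n0 ni nj nk a0 ai aj ak)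
    (hi : ui < ai) (hj : uj < aj) (hk : uk < ak)
    (hcrit : a0 * n0 ≠ ui * ni + uj * nj + uk * nk)
    (hmin : ∀ a b c d, 0 < a → a * n0 + b * ni + c * nj + d * nk = ui * ni + uj * nj + uk * nk →
      (0 < ui → b = 0) ∧ (0 < uj → c = 0) ∧ (0 < uk → d = 0))
    {a b c d : ℕ} (ha : 0 < a)
    (h : a * n0 + b * ni + c * nj + d * nk = ui * ni + uj * nj + uk * nk) :
    (0 < ui ∧ 0 < uj ∧ uk = 0 ∧ b = 0 ∧ c = 0 ∧ 0 < d ∧ a < a0 ∧ d < ak) ∨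
    (0 < ui ∧ uj = 0 ∧ 0 < uk ∧ b = 0 ∧ 0 < c ∧ d = 0 ∧ a < a0 ∧ c < aj) ∨
    (ui = 0 ∧ 0 < uj ∧ 0 < uk ∧ ∃ a' b', 0 < a' ∧ 0 < b' ∧
      a' * n0 + b' * ni = uj * nj + uk * nk) := by
  have hdisj := hmin a b c d ha h
  have ha0 : 0 < a * n0 := Nat.mul_pos ha H.p0
  have e0 := H.h0
  have ej := H.hj
  have hai : 0 < ai := by omega
  have haj : 0 < aj := by omega
  have hak : 0 < ak := by omega
  -- a pure power of `x₀` can be rewritten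
  have hpow : a * n0 = ui * ni + uj * nj + uk * nk →
      ∃ e, 0 < e ∧ e * n0 + ai * ni = ui * ni + uj * nj + uk * nk := by
    intro h1
    obtain ⟨e, rfl⟩ := Nat.exists_eq_add_of_le (H.c0 a ui uj uk ha h1)
    refine ⟨e, Nat.pos_of_ne_zero ?_, by linarith⟩
    rintro rfl
    exact hcrit h1
  rcases Nat.eq_zero_or_pos ui with rfl | hi0 <;> rcases Nat.eq_zero_or_pos uj with rfl | hj0 <;>
    rcases Nat.eq_zero_or_pos uk with rfl | hk0
  · omega
  · obtain rfl : d = 0 := by omega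
    have := H.ck uk a b c hk0 (by omega)
    omega
  · obtain rfl : c = 0 := by omega
    have := H.cj uj a b d hj0 (by omega)
    omega
  · obtain rfl : d = 0 := by omega
    obtain rfl : c = 0 := by omega
    refine Or.inr (Or.inr ⟨rfl, hj0, hk0, ?_⟩)
    rcases Nat.eq_zero_or_pos b with rfl | hb0
    · obtain ⟨e, he, h1⟩ := hpow (by omega)
      exact ⟨e, ai, he, hai, by omega⟩
    · exact ⟨a, b, ha, hb0, by omega⟩
  · obtain rfl : b = 0 := by omega
    have := H.ci ui a c d hi0 (by omega)
    omega
  · obtain rfl : b = 0 := by omega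
    obtain rfl : d = 0 := by omega
    refine Or.inr (Or.inl ⟨hi0, rfl, hk0, rfl, ?_, rfl, ?_, ?_⟩)
    · by_contra hc0
      obtain rfl : c = 0 := by omega
      obtain ⟨e, he, h1⟩ := hpow (by omega)
      have := hmin e ai 0 0 he (by omega)
      omega
    · by_contra hlt
      -- Trading `x₀ ^ a₀` for `xᵢ ^ aᵢ` creates a shared `xᵢ`. For `e > 0` this contradicts `hmin`;
      -- for `e = 0`, cancelling `xᵢ ^ uᵢ` contradicts the minimality of `ak`.
      obtain ⟨e, rfl⟩ := Nat.exists_eq_add_of_le (not_lt.1 hlt)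
      rcases Nat.eq_zero_or_pos e with rfl | he
      · obtain ⟨f, rfl⟩ := Nat.exists_eq_add_of_lt hi
        have := H.ck uk 0 (f + 1) c hk0 (by linarith)
        omega
      · have := hmin e ai c 0 he (by linarith)
        omega
    · by_contra hlt
      -- Trading `xⱼ ^ aⱼ` for `xₖ ^ aₖ` would create a shared `xₖ`.
      obtain ⟨e, rfl⟩ := Nat.exists_eq_add_of_le (not_lt.1 hlt)
      have := hmin a 0 e ak ha (by linarith)
      omega
  · obtain rfl : b = 0 := by omega
    obtain rfl : c = 0 := by omega
    refine Or.inl ⟨hi0, hj0, rfl, rfl, rfl, ?_, ?_, ?_⟩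
    · by_contra hd0
      obtain rfl : d = 0 := by omega
      obtain ⟨e, he, h1⟩ := hpow (by omega)
      have := hmin e ai 0 0 he (by omega)
      omega
    · by_contra hlt
      obtain ⟨e, rfl⟩ := Nat.exists_eq_add_of_le (not_lt.1 hlt)
      rcases Nat.eq_zero_or_pos e with rfl | he
      · obtain ⟨f, rfl⟩ := Nat.exists_eq_add_of_lt hi
        have := H.cj uj 0 (f + 1) d hj0 (by linarith)
        omega
      · have := hmin e ai 0 d he (by linarith)
        omega
    · by_contra hlt
      obtain ⟨e, rfl⟩ := Nat.exists_eq_add_of_le (not_lt.1 hlt)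
      have := hmin a 0 aj e ha (by linarith)
      omega
  · obtain rfl : b = 0 := by omega
    obtain rfl : c = 0 := by omega
    obtain rfl : d = 0 := by omega
    obtain ⟨e, he, h1⟩ := hpow (by omega)
    have := hmin e ai 0 0 he (by omega)
    omega

/-! ### The combinatorial criterion -/

/-- Every monomial whose `𝒮`-degree lies in `n₀ + 𝒮` is equivalent to a monomial divisible by `x₀`
whose degree is at least as large. -/
def LiftsToZero (n : Fin 4 → ℕ) : Prop :=
  ∀ u p : Fin 4 →₀ ℕ, 0 < p 0 → degS n p = degS n u →
    ∃ v : Fin 4 →₀ ℕ, 0 < v 0 ∧ degS n v = degS n u ∧ u.degree ≤ v.degree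

/-- One factor `x₀` is removed or restored. In the converse, the lift is `x₀` times a top monomial
equivalent to `p / x₀`. -/
lemma liftsToZero_iff (hn : ∀ i, 0 < n i) :
    LiftsToZero n ↔ ∀ u, IsTop n u → IsTop n (Finsupp.single 0 1 + u) := by
  constructor
  · intro h u hu w hw
    obtain ⟨v, hv0, hv, hd⟩ := h w (Finsupp.single 0 1 + u) (by simp) hw.symm
    obtain ⟨v', rfl⟩ : ∃ v', v = Finsupp.single 0 1 + v' :=
      exists_add_of_le (Finsupp.single_le_iff.2 hv0)
    have := hu v' (by rw [hw, degS_add, degS_add] at hv; omega)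
    rw [map_add] at hd ⊢
    omega
  · intro h u p hp hpu
    obtain ⟨p', rfl⟩ : ∃ p', p = Finsupp.single 0 1 + p' :=
      exists_add_of_le (Finsupp.single_le_iff.2 hp)
    obtain ⟨v, hv, ht⟩ := exists_isTop hn p'
    have hdeg : degS n (Finsupp.single 0 1 + v) = degS n u := by
      rw [← hpu, degS_add, degS_add, hv]
    exact ⟨_, by simp, hdeg, h v ht u hdeg.symm⟩

/-! ### Exponent vectors in the order `0, i, j, k` -/

lemma eq_or_of_nodup : ∀ {p q r s : Fin 4}, [p, q, r, s].Nodup →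
    ∀ l, l = p ∨ l = q ∨ l = r ∨ l = s := by
  decide

lemma nodup_rotate : ∀ {p q r s : Fin 4}, [p, q, r, s].Nodup → [p, s, q, r].Nodup := by
  decide

lemma nodup_swap : ∀ {p q r s : Fin 4}, [p, q, r, s].Nodup → [r, s, p, q].Nodup := by
  decide

lemma sum_of_nodup {p q r s : Fin 4} (h : [p, q, r, s].Nodup) (f : Fin 4 → ℕ) :
    ∑ l, f l = f p + f q + f r + f s := by
  have huniv : (Finset.univ : Finset (Fin 4)) = {p, q, r, s} := by
    ext l
    simpa using eq_or_of_nodup h l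
  simp only [List.nodup_cons, List.mem_cons, List.not_mem_nil, or_false, not_or] at h
  rw [huniv, Finset.sum_insert (by simp; tauto), Finset.sum_insert (by simp; tauto),
    Finset.sum_insert (by simp; tauto), Finset.sum_singleton]
  ring

lemma degS_of_nodup {p q r s : Fin 4} (h : [p, q, r, s].Nodup) (u : Fin 4 →₀ ℕ) :
    degS n u = u p * n p + u q * n q + u r * n r + u s * n s := sum_of_nodup h _

lemma degree_of_nodup {p q r s : Fin 4} (h : [p, q, r, s].Nodup) (u : Fin 4 →₀ ℕ) :
    u.degree = u p + u q + u r + u s := by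
  rw [Finsupp.degree_eq_sum, sum_of_nodup h]

lemma ext_of_nodup {p q r s : Fin 4} (h : [p, q, r, s].Nodup) {u v : Fin 4 →₀ ℕ}
    (hp : u p = v p) (hq : u q = v q) (hr : u r = v r) (hs : u s = v s) : u = v := by
  ext l
  rcases eq_or_of_nodup h l with rfl | rfl | rfl | rfl <;> assumption

lemma exists_of_nodup {p q r s : Fin 4} (h : [p, q, r, s].Nodup) (a b c d : ℕ) :
    ∃ u : Fin 4 →₀ ℕ, u p = a ∧ u q = b ∧ u r = c ∧ u s = d := by
  simp only [List.nodup_cons, List.mem_cons, List.not_mem_nil, or_false, not_or] at h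
  obtain ⟨⟨h1, h2, h3⟩, ⟨h4, h5⟩, h6, -⟩ := h
  refine ⟨Finsupp.single p a + Finsupp.single q b + Finsupp.single r c + Finsupp.single s d, ?_⟩
  simp [h1, h2, h3, h4, h5, h6, Ne.symm h1, Ne.symm h2, Ne.symm h3, Ne.symm h4, Ne.symm h5,
    Ne.symm h6]

lemma support_eq_pair {p q r s : Fin 4} (h : [p, q, r, s].Nodup) {u : Fin 4 →₀ ℕ}
    (hp : 0 < u p) (hq : 0 < u q) (hr : u r = 0) (hs : u s = 0) : u.support = {p, q} := by
  ext l
  rw [Finsupp.mem_support_iff, Finset.mem_insert, Finset.mem_singleton]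
  rcases eq_or_of_nodup h l with rfl | rfl | rfl | rfl
  · simp [hp.ne']
  · simp [hq.ne']
  · simp only [hr, ne_eq, not_true_eq_false, false_iff]
    rintro (rfl | rfl) <;> omega
  · simp only [hs, ne_eq, not_true_eq_false, false_iff]
    rintro (rfl | rfl) <;> omega

lemma of_support_eq_pair {p q r s : Fin 4} (h : [p, q, r, s].Nodup) {u : Fin 4 →₀ ℕ}
    (hu : u.support = {p, q}) : 0 < u p ∧ 0 < u q ∧ u r = 0 ∧ u s = 0 := by
  simp only [List.nodup_cons, List.mem_cons, List.not_mem_nil, or_false, not_or] at h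
  have hmem : ∀ l, u l ≠ 0 ↔ l = p ∨ l = q := fun l => by
    rw [← Finsupp.mem_support_iff, hu]
    simp
  refine ⟨Nat.pos_of_ne_zero ((hmem p).2 (Or.inl rfl)),
    Nat.pos_of_ne_zero ((hmem q).2 (Or.inr rfl)), ?_, ?_⟩
  · by_contra h1
    have := (hmem r).1 h1
    tauto
  · by_contra h1
    have := (hmem s).1 h1
    tauto

/-- Two equivalent monomials in `x_p, x_q` agree if one of them is bounded. -/
lemma eq_of_lt_critExp {p q r s : Fin 4} (h : [p, q, r, s].Nodup) {u v : Fin 4 →₀ ℕ}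
    (hpos : ∀ l, 0 < n l) (hu : u r = 0 ∧ u s = 0) (hv : v r = 0 ∧ v s = 0)
    (hp : v p < critExp n p) (hq : v q < critExp n q) (huv : degS n u = degS n v) : u = v := by
  have key : ∀ {p q r s : Fin 4}, [p, q, r, s].Nodup → v q < critExp n q →
      u p * n p + u q * n q = v p * n p + v q * n q → u p ≤ v p := by
    intro p q r s h hq huv
    by_contra hlt
    obtain ⟨e, he⟩ := Nat.exists_eq_add_of_lt (not_le.1 hlt)
    have hnp := hpos p
    have hlt2 : u q < v q := by
      by_contra hle
      have h1 : v q * n q ≤ u q * n q := Nat.mul_le_mul_right _ (not_lt.1 hle)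
      have h2 : v p * n p < u p * n p := Nat.mul_lt_mul_of_pos_right (not_le.1 hlt) hnp
      omega
    obtain ⟨f, hf⟩ := Nat.exists_eq_add_of_lt hlt2
    obtain ⟨w, hw1, hw2, hw3, hw4⟩ := exists_of_nodup h (e + 1) 0 0 0
    have := critExp_le (n := n) (l := q) (c := f + 1) (by omega) (u := w) hw2 (by
      rw [degS_of_nodup h, hw1, hw2, hw3, hw4]
      rw [he, hf] at huv
      linarith)
    omega
  have hsum : u p * n p + u q * n q = v p * n p + v q * n q := by
    rw [degS_of_nodup h, degS_of_nodup h, hu.1, hu.2, hv.1, hv.2] at huv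
    omega
  have h' : [q, p, r, s].Nodup := by
    refine (List.Perm.nodup_iff ?_).1 h
    exact List.Perm.swap _ _ _
  have h1 := key h hq hsum
  have h2 := key h' hp (by omega)
  have h3 : u p * n p ≤ v p * n p := Nat.mul_le_mul_right _ h1
  have h4 : u q * n q ≤ v q * n q := Nat.mul_le_mul_right _ h2
  refine ext_of_nodup h ?_ ?_ (hu.1.trans hv.1.symm) (hu.2.trans hv.2.symm)
  · exact Nat.eq_of_mul_eq_mul_right (hpos p) (by omega)
  · exact Nat.eq_of_mul_eq_mul_right (hpos q) (by omega)

/-- The indispensable side is isolated. If it is `N`, the lift of `N` avoids its variables and lives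
in those of the bounded `M`, so it equals `M`. If it is `M`, the lift shares `x₀` with `M` and again
equals it. -/
lemma degree_le_of_mem_setI (hn : ∀ l, 0 < n l) (h : LiftsToZero n) {M N : Fin 4 →₀ ℕ}
    (hf : mon K M - mon K N ∈ setI K n) (h0 : 0 ∈ M.support) : N.degree ≤ M.degree := by
  obtain ⟨hI, p, q, r, s, v, w, hnd, hv, hw, hvp, hvq, hind, heq⟩ := hf
  have hM0 : 0 < M 0 := Nat.pos_of_ne_zero (Finsupp.mem_support_iff.1 h0)
  have hdeg := mon_sub_mon_mem_toricIdeal.1 hI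
  have hiso := IsIsolated.of_isIndispensableMonomial hn hind
  have hnd' := nodup_swap hnd
  obtain ⟨hp0, hq0, hr0, hs0⟩ := of_support_eq_pair hnd hv
  obtain ⟨hr1, hs1, hp1, hq1⟩ := of_support_eq_pair hnd' hw
  have hvw : v ≠ w := by rintro rfl; omega
  obtain ⟨P, hP0, hP, hd⟩ := h N M hM0 hdeg
  rcases mon_sub_mon_eq hvw heq with ⟨rfl, rfl⟩ | ⟨rfl, rfl⟩
  · have hPN : P ≠ N := by
      rintro rfl
      have : ∀ l, ¬ (0 < M l ∧ 0 < P l) := fun l => by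
        rcases eq_or_of_nodup hnd l with rfl | rfl | rfl | rfl <;> omega
      exact this 0 ⟨hM0, hP0⟩
    have := eq_of_lt_critExp hnd hn ⟨hiso P hP hPN r hr1, hiso P hP hPN s hs1⟩ ⟨hr0, hs0⟩ hvp hvq
      (hP.trans hdeg.symm)
    rwa [this] at hd
  · have hPM : P = M := by
      by_contra hne
      have := hiso P (hP.trans hdeg.symm) hne 0 hM0
      omega
    rwa [hPM] at hd

/-! ### Case 2(b) -/

section Case

variable {i j k : Fin 4}

lemma IsCase2b.numCase (hcase : IsCase2b K n i j k) (hn : ∀ l, 0 < n l) :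
    NumCase (n 0) (n i) (n j) (n k) (critExp n 0) (critExp n i) (critExp n j) (critExp n k) := by
  have key : ∀ l a b c d, (∃ u : Fin 4 →₀ ℕ, u 0 = a ∧ u i = b ∧ u j = c ∧ u k = d ∧ u l = 0) →
      ∀ e, 0 < e → e * n l = a * n 0 + b * n i + c * n j + d * n k → critExp n l ≤ e := by
    rintro l _ _ _ _ ⟨u, rfl, rfl, rfl, rfl, hl⟩ e he h
    exact critExp_le he hl (by rw [h, degS_of_nodup hcase.indices])
  refine ⟨hcase.deg_left, hcase.deg_right, hn i, hn j, hn k, hn 0, critExp_pos hn 0, ?_, ?_, ?_, ?_⟩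
  · intro c x y z hc h
    obtain ⟨u, h1, h2, h3, h4⟩ := exists_of_nodup hcase.indices 0 x y z
    exact key 0 0 x y z ⟨u, h1, h2, h3, h4, h1⟩ c hc (by omega)
  · intro c x y z hc h
    obtain ⟨u, h1, h2, h3, h4⟩ := exists_of_nodup hcase.indices x 0 y z
    exact key i x 0 y z ⟨u, h1, h2, h3, h4, h2⟩ c hc (by omega)
  · intro c x y z hc h
    obtain ⟨u, h1, h2, h3, h4⟩ := exists_of_nodup hcase.indices x y 0 z
    exact key j x y 0 z ⟨u, h1, h2, h3, h4, h3⟩ c hc (by omega)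
  · intro c x y z hc h
    obtain ⟨u, h1, h2, h3, h4⟩ := exists_of_nodup hcase.indices x y z 0
    exact key k x y z 0 ⟨u, h1, h2, h3, h4, h4⟩ c hc (by omega)

/-- No bounded monomial in `xᵢ, xⱼ, xₖ` is equivalent to `x₀ ^ a₀`. -/
lemma IsCase2b.critExp_mul_ne (hcase : IsCase2b K n i j k) (hn : ∀ l, 0 < n l)
    {M : Fin 4 →₀ ℕ} (h0 : M 0 = 0) (hi : M i < critExp n i) (hj : M j < critExp n j)
    (hk : M k < critExp n k) : critExp n 0 * n 0 ≠ degS n M := by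
  intro h
  have hpos := critExp_pos hn 0
  have hmem : mon K (Finsupp.single 0 (critExp n 0)) - mon K M ∈ criticalIdeal K n := by
    refine Ideal.subset_span (Set.mem_iUnion.2 ⟨0, ?_, M, h0, ?_⟩)
    · rw [mon_sub_mon_mem_toricIdeal, degS_single, h]
    · rw [X_pow_eq_mon]
  rw [hcase.span_eq] at hmem
  have hne : ∀ l, M l < critExp n l → ∀ u, u + Finsupp.single l (critExp n l) ≠ M := by
    rintro l hl u rfl
    simp at hl
  -- Otherwise `x₀ ^ a₀ - x^M` would be a critical binomial, but all exponents of `M` are below the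
  -- critical ones, so no monomial multiple of the two generators contains `x^M`.
  have := coeff_eq_zero_of_mem_span (w := M) (fun g hg u => ?_) hmem
  · rw [coeff_sub, coeff_mon, coeff_mon, if_pos rfl, if_neg] at this
    · simp at this
    · rintro rfl
      simp at h0
      omega
  · rcases hg with rfl | hg
    · rw [X_pow_eq_mon, X_pow_eq_mon, mul_sub, mon_mul, mon_mul, coeff_sub, coeff_mon, coeff_mon,
        if_neg (hne 0 (by omega) u), if_neg (hne i hi u), sub_zero]
    · rw [Set.mem_singleton_iff] at hg
      rw [hg, X_pow_eq_mon, X_pow_eq_mon, mul_sub, mon_mul, mon_mul, coeff_sub, coeff_mon,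
        coeff_mon, if_neg (hne j hj u), if_neg (hne k hk u), sub_zero]

lemma add_single_sub_single_degS (hcase : IsCase2b K n i j k) {u : Fin 4 →₀ ℕ} {α : ℕ}
    (h : α * critExp n i ≤ u i) :
    degS n (u + Finsupp.single 0 (α * critExp n 0) - Finsupp.single i (α * critExp n i)) =
      degS n u := by
  have hle : Finsupp.single i (α * critExp n i) ≤ u + Finsupp.single 0 (α * critExp n 0) := by
    rw [Finsupp.single_le_iff, Finsupp.add_apply]
    omega
  have := congrArg (degS n) (tsub_add_cancel_of_le hle)
  rw [degS_add, degS_add, degS_single, degS_single, mul_assoc, mul_assoc, hcase.deg_left] at this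
  omega

/-- The binomial of an isolated bounded monomial in `xⱼ, xₖ` and an equivalent monomial in `x₀, xᵢ`
lies in `𝓘` or in `𝓡`. -/
lemma IsCase2b.mem_setR (hcase : IsCase2b K n i j k) {P M : Fin 4 →₀ ℕ}
    (hP : P.support = {0, i}) (hM : M.support = {j, k})
    (hj : M j < critExp n j) (hk : M k < critExp n k) (hPM : degS n P = degS n M)
    (hiso : IsIsolated n M) (hI : mon K P - mon K M ∉ setI K n) :
    mon K P - mon K M ∈ setR K n i j k := by
  have hnd := hcase.indices
  have hnd' := nodup_swap hnd
  obtain ⟨hP0, hPi, hPj, hPk⟩ := of_support_eq_pair hnd hP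
  obtain ⟨hMj, hMk, hM0, hMi⟩ := of_support_eq_pair hnd' hM
  refine ⟨mon_sub_mon_mem_toricIdeal.2 hPM, hI, P, M, hP, hM, rfl, Or.inr hj.le, ?_⟩
  rintro ⟨v, w, hv, hw, hvw, ⟨α, hα, hlt⟩ | ⟨α, hα, hlt⟩⟩
  all_goals
    rw [mon_sub_mon_mem_toricIdeal] at hvw
    obtain ⟨hv0, hvi, hvj, hvk⟩ := of_support_eq_pair hnd hv
    obtain ⟨hwj, hwk, hw0, hwi⟩ := of_support_eq_pair hnd' hw
    obtain ⟨t, ht⟩ := exists_add_of_le hlt.le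
    have ht0 : t ≠ 0 := by
      rintro rfl
      rw [add_zero] at ht
      exact hlt.ne ht.symm
  · have hdeg := add_single_sub_single_degS hcase hα
    rw [ht, degS_add] at hdeg
    -- The shifted monomial is `v + t`, so `w + t` is equivalent to `M` and shares `xⱼ` with it.
    -- Isolation gives equality, and comparing supports then forces `t = 0`.
    have hQ : w + t = M := by
      by_contra hne
      have := hiso (w + t) (by rw [degS_add]; omega) hne j hMj
      rw [Finsupp.add_apply] at this
      omega
    have hti : w i + t i = M i := by rw [← hQ, Finsupp.add_apply]
    have htz : w 0 + t 0 = M 0 := by rw [← hQ, Finsupp.add_apply]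
    have hle : ∀ l, P l = 0 → l ≠ 0 → t l = 0 := by
      intro l hl h0
      have := DFunLike.congr_fun ht l
      simp only [Finsupp.coe_tsub, Finsupp.coe_add, Pi.sub_apply, Pi.add_apply, hl,
        Finsupp.single_eq_of_ne h0] at this
      omega
    have hj0 : j ≠ 0 := by rintro rfl; omega
    have hk0 : k ≠ 0 := by rintro rfl; omega
    refine ht0 (ext_of_nodup hnd ?_ ?_ (hle j hPj hj0) (hle k hPk hk0))
    · simp; omega
    · simp; omega
  -- The bound on the exponent of `xₖ` excludes any shift, so `M = w + t`. Then `v + t` is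
  -- equivalent to `M`, differs from it by `x₀`, and shares a variable of `t`, against isolation.
  · have hα0 : α = 0 := by
      by_contra hne
      have := Nat.le_mul_of_pos_left (critExp n k) (Nat.pos_of_ne_zero hne)
      omega
    subst hα0
    simp only [zero_mul, Finsupp.single_zero, add_zero, tsub_zero] at ht
    obtain ⟨l, hl⟩ := Finsupp.ne_iff.1 ht0
    rw [Finsupp.coe_zero, Pi.zero_apply] at hl
    have := hiso (v + t) (by rw [ht, degS_add, degS_add, hvw])
      (by intro h; have := DFunLike.congr_fun h 0; rw [Finsupp.add_apply] at this; omega) l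
      (by rw [ht, Finsupp.add_apply]; omega)
    rw [Finsupp.add_apply] at this
    omega

/-- The inductive step for bounded monomials without common variables. -/
lemma IsCase2b.exists_of_not_share (hcase : IsCase2b K n i j k) (hn : ∀ l, 0 < n l)
    (h1 : ∀ M N : Fin 4 →₀ ℕ, mon K M - mon K N ∈ setI K n → 0 ∈ M.support →
      N.degree ≤ M.degree)
    (h2 : ∀ M N : Fin 4 →₀ ℕ, mon K M - mon K N ∈ setR K n i j k → 0 ∈ M.support →
      ∃ P : Fin 4 →₀ ℕ, 0 ∈ P.support ∧ degS n N = degS n P ∧ N.degree ≤ P.degree)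
    {M P : Fin 4 →₀ ℕ} (hM0 : M 0 = 0) (hi : M i < critExp n i) (hj : M j < critExp n j)
    (hk : M k < critExp n k) (hP0 : 0 < P 0) (hP : degS n P = degS n M)
    (hmin : ∀ Q, degS n Q = degS n M → 0 < Q 0 → ∀ l, 0 < M l → Q l = 0) :
    ∃ N : Fin 4 →₀ ℕ, 0 < N 0 ∧ degS n N = degS n M ∧ M.degree ≤ N.degree := by
  have hnd := hcase.indices
  have H := hcase.numCase hn
  have hdegM : degS n M = M i * n i + M j * n j + M k * n k := by
    rw [degS_of_nodup hnd, hM0]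
    omega
  have hmin' : ∀ a b c d, 0 < a → a * n 0 + b * n i + c * n j + d * n k =
      M i * n i + M j * n j + M k * n k →
      (0 < M i → b = 0) ∧ (0 < M j → c = 0) ∧ (0 < M k → d = 0) := by
    intro a b c d ha h
    obtain ⟨Q, rfl, rfl, rfl, rfl⟩ := exists_of_nodup hnd a b c d
    have := hmin Q (by rw [degS_of_nodup hnd, h, hdegM]) ha
    exact ⟨this i, this j, this k⟩
  have hiso : IsIsolated n M := by
    intro Q hQ hne l hl
    have := H.isolated hi hj hk hmin' (a := Q 0) (b := Q i) (c := Q j) (d := Q k)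
      (by rw [← degS_of_nodup hnd, hQ, hdegM]) (by
        rintro ⟨ei, ej, ek⟩
        refine hne (ext_of_nodup hnd ?_ ei ej ek)
        rw [degS_of_nodup hnd, hdegM, ei, ej, ek] at hQ
        have : Q 0 * n 0 = 0 := by omega
        have h0 := hn 0
        rw [hM0]
        exact (Nat.mul_eq_zero.1 this).resolve_right h0.ne')
    rcases eq_or_of_nodup hnd l with rfl | rfl | rfl | rfl
    · omega
    · exact this.1 hl
    · exact this.2.1 hl
    · exact this.2.2 hl
  have hnd1 := nodup_rotate hnd
  have hnd2 := nodup_rotate hnd1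
  rcases H.cases hi hj hk (hdegM ▸ hcase.critExp_mul_ne hn hM0 hi hj hk) hmin' hP0
    (by rw [← degS_of_nodup hnd, hP, hdegM]) with
    ⟨hi0, hj0, hk0, hPi, hPj, hPk, hb0, hbk⟩ | ⟨hi0, hj0, hk0, hPi, hPj, hPk, hb0, hbj⟩ |
    ⟨hi0, hj0, hk0, a, b, ha, hb, hab⟩
  · have hne : P ≠ M := by rintro rfl; omega
    refine ⟨P, hP0, hP, h1 P M ⟨mon_sub_mon_mem_toricIdeal.2 hP, 0, k, i, j, P, M, ?_, ?_, ?_,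
      hb0, hbk, hiso.isIndispensableMonomial hP hne, rfl⟩ (by simpa using hP0.ne')⟩
    · exact hnd1
    · exact support_eq_pair hnd1 hP0 hPk hPi hPj
    · exact support_eq_pair (nodup_swap hnd1) hi0 hj0 hM0 hk0
  · have hne : P ≠ M := by rintro rfl; omega
    refine ⟨P, hP0, hP, h1 P M ⟨mon_sub_mon_mem_toricIdeal.2 hP, 0, j, k, i, P, M, ?_, ?_, ?_,
      hb0, hbj, hiso.isIndispensableMonomial hP hne, rfl⟩ (by simpa using hP0.ne')⟩
    · exact hnd2
    · exact support_eq_pair hnd2 hP0 hPj hPk hPi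
    · exact support_eq_pair (nodup_swap hnd2) hk0 hi0 hM0 hj0
  · obtain ⟨Q, rfl, rfl, hQj, hQk⟩ := exists_of_nodup hnd a b 0 0
    have hQ : degS n Q = degS n M := by
      rw [degS_of_nodup hnd, hdegM, hQj, hQk, hi0]
      omega
    have hQ0 : 0 ∈ Q.support := by simpa using ha.ne'
    by_cases hI : mon K Q - mon K M ∈ setI K n
    · exact ⟨Q, ha, hQ, h1 Q M hI hQ0⟩
    · have hMs : M.support = {j, k} := support_eq_pair (nodup_swap hnd) hj0 hk0 hM0 hi0
      obtain ⟨N, hN0, hN, hd⟩ := h2 Q M (hcase.mem_setR (support_eq_pair hnd ha hb hQj hQk) hMs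
        hj hk hQ hiso hI) hQ0
      exact ⟨N, Nat.pos_of_ne_zero (Finsupp.mem_support_iff.1 hN0), hN.symm, hd⟩

lemma IsCase2b.liftsToZero (hcase : IsCase2b K n i j k) (hpos : 0 < n 0) (hmono : StrictMono n)
    (hjk : n j < n k)
    (h1 : ∀ M N : Fin 4 →₀ ℕ, mon K M - mon K N ∈ setI K n → 0 ∈ M.support →
      N.degree ≤ M.degree)
    (h2 : ∀ M N : Fin 4 →₀ ℕ, mon K M - mon K N ∈ setR K n i j k → 0 ∈ M.support →
      ∃ P : Fin 4 →₀ ℕ, 0 ∈ P.support ∧ degS n N = degS n P ∧ N.degree ≤ P.degree)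
    (h3 : ∀ M : Fin 4 →₀ ℕ, 0 ∉ M.support → M i < critExp n i → critExp n j ≤ M j →
      M k < critExp n k → (∃ s ∈ semigroup n, degS n M = n 0 + s) →
      ∃ N : Fin 4 →₀ ℕ, 0 ∈ N.support ∧ mon K M - mon K N ∈ toricIdeal K n ∧
        M.degree ≤ N.degree) :
    LiftsToZero n := by
  have hn : ∀ l, 0 < n l := fun l => hpos.trans_le (hmono.monotone (Fin.zero_le l))
  have hnd := hcase.indices
  have hi0 : i ≠ 0 := by rintro rfl; simp at hnd
  have lt_of : ∀ p q, n p < n q → critExp n p * n p = critExp n q * n q →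
      critExp n q < critExp n p := by
    intro p q hpq h
    have hq := critExp_pos hn q
    by_contra hle
    have h4 : critExp n p * n p ≤ critExp n q * n p := Nat.mul_le_mul_right _ (not_lt.1 hle)
    have h5 : critExp n q * n p < critExp n q * n q := Nat.mul_lt_mul_of_pos_left hpq hq
    omega
  have ha0 := lt_of 0 i (hmono (Fin.pos_of_ne_zero hi0)) hcase.deg_left
  have haj := lt_of j k hjk hcase.deg_right
  have e0 := hcase.deg_left
  have ej := hcase.deg_right
  suffices H : ∀ s, ∀ M P : Fin 4 →₀ ℕ, degS n M = s → 0 < P 0 → degS n P = degS n M →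
      ∃ N : Fin 4 →₀ ℕ, 0 < N 0 ∧ degS n N = degS n M ∧ M.degree ≤ N.degree from
    fun M P hP0 hP => H _ M P rfl hP0 hP
  intro s
  induction s using Nat.strong_induction_on with
  | _ s ih =>
  -- the case of a bounded exponent of `xₖ`
  have hred : ∀ M P : Fin 4 →₀ ℕ, degS n M = s → 0 < P 0 → degS n P = degS n M → M 0 = 0 →
      M i < critExp n i → M k < critExp n k →
      ∃ N : Fin 4 →₀ ℕ, 0 < N 0 ∧ degS n N = degS n M ∧ M.degree ≤ N.degree := by
    intro M P hM hP0 hP hM0 hi hk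
    rcases Nat.lt_or_ge (M j) (critExp n j) with hj | hj
    · by_cases hshare : ∃ Q, degS n Q = degS n M ∧ 0 < Q 0 ∧ ∃ l, 0 < M l ∧ 0 < Q l
      · obtain ⟨Q, hQ, hQ0, l, hMl, hQl⟩ := hshare
        obtain ⟨M', rfl⟩ : ∃ M', M = Finsupp.single l 1 + M' :=
          exists_add_of_le (Finsupp.single_le_iff.2 hMl)
        obtain ⟨Q', rfl⟩ : ∃ Q', Q = Finsupp.single l 1 + Q' :=
          exists_add_of_le (Finsupp.single_le_iff.2 hQl)
        have hl : l ≠ 0 := by rintro rfl; omega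
        have hnl := hn l
        rw [Finsupp.add_apply, Finsupp.single_eq_of_ne hl.symm, zero_add] at hQ0
        rw [degS_add, degS_add] at hQ
        rw [degS_add, degS_single] at hM
        obtain ⟨N, hN0, hN, hd⟩ := ih (degS n M') (by omega) M' Q' rfl hQ0 (by omega)
        refine ⟨Finsupp.single l 1 + N, by rw [Finsupp.add_apply]; omega, ?_, ?_⟩
        · rw [degS_add, degS_add, hN]
        · rw [map_add, map_add]
          omega
      · refine hcase.exists_of_not_share hn h1 h2 hM0 hi hj hk hP0 hP fun Q hQ hQ0 l hl => ?_
        by_contra hne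
        exact hshare ⟨Q, hQ, hQ0, l, hl, Nat.pos_of_ne_zero hne⟩
    · obtain ⟨P', rfl⟩ : ∃ P', P = Finsupp.single 0 1 + P' :=
        exists_add_of_le (Finsupp.single_le_iff.2 hP0)
      obtain ⟨N, hN0, hN, hd⟩ := h3 M (by simpa using hM0) hi hj hk
        ⟨degS n P', mem_semigroup.2 ⟨P', rfl⟩, by rw [← hP, degS_add, degS_single, one_mul]⟩
      exact ⟨N, Nat.pos_of_ne_zero (Finsupp.mem_support_iff.1 hN0),
        (mon_sub_mon_mem_toricIdeal.1 hN).symm, hd⟩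
  intro M P hM hP0 hP
  rcases Nat.eq_zero_or_pos (M 0) with hM0 | hM0
  · rcases Nat.lt_or_ge (M i) (critExp n i) with hi | hi
    -- All complete blocks `xₖ ^ aₖ` are replaced by `xⱼ ^ aⱼ`; since `aₖ < aⱼ` the degree does not
    -- drop.
    · obtain ⟨M', h0', hi', hj', hk'⟩ := exists_of_nodup hnd 0 (M i)
        (M j + M k / critExp n k * critExp n j) (M k % critExp n k)
      have hdiv := Nat.mod_add_div (M k) (critExp n k)
      have hM' : degS n M' = degS n M := by
        rw [degS_of_nodup hnd, degS_of_nodup hnd, h0', hi', hj', hk', hM0, add_mul,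
          mul_assoc (M k / critExp n k), ej]
        have := congrArg (· * n k) hdiv
        linarith
      have hd : M.degree ≤ M'.degree := by
        rw [degree_of_nodup hnd, degree_of_nodup hnd, h0', hi', hj', hk', hM0]
        have := Nat.mul_le_mul_left (M k / critExp n k) haj.le
        rw [mul_comm] at hdiv
        omega
      obtain ⟨N, hN0, hN, hd'⟩ := hred M' P (hM'.trans hM) hP0 (hP.trans hM'.symm) h0'
        (hi'.trans_lt hi) (hk'.trans_lt (Nat.mod_lt _ (critExp_pos hn k)))
      exact ⟨N, hN0, hN.trans hM', hd.trans hd'⟩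
    -- Replacing one `xᵢ ^ aᵢ` by `x₀ ^ a₀` produces the required `x₀` at once.
    · obtain ⟨e, he⟩ := Nat.exists_eq_add_of_le hi
      obtain ⟨N, hN0, hNi, hNj, hNk⟩ := exists_of_nodup hnd (critExp n 0) e (M j) (M k)
      refine ⟨N, hN0 ▸ critExp_pos hn 0, ?_, ?_⟩
      · rw [degS_of_nodup hnd, degS_of_nodup hnd, hN0, hNi, hNj, hNk, hM0, he, e0]
        ring
      · rw [degree_of_nodup hnd, degree_of_nodup hnd, hN0, hNi, hNj, hNk, hM0, he]
        omega
  · exact ⟨M, hM0, rfl, le_rfl⟩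

end Case

end MonomialCurve

theorem mainTheorem11 (K : Type*) [Field K] (n : Fin 4 → ℕ) (hpos : 0 < n 0)
    (hmono : StrictMono n) (hgcd : Finset.univ.gcd n = 1)
    (i j k : Fin 4) (hcase : MonomialCurve.IsCase2b K n i j k) (hjk : n j < n k) :
    MonomialCurve.HasCohenMacaulayTangentCone K n ↔
      (∀ M N : Fin 4 →₀ ℕ,
        MonomialCurve.mon K M - MonomialCurve.mon K N ∈ MonomialCurve.setI K n →
          0 ∈ M.support → N.degree ≤ M.degree) ∧
      (∀ M N : Fin 4 →₀ ℕ,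
        MonomialCurve.mon K M - MonomialCurve.mon K N ∈ MonomialCurve.setR K n i j k →
          0 ∈ M.support →
          ∃ P : Fin 4 →₀ ℕ, 0 ∈ P.support ∧
            MonomialCurve.degS n N = MonomialCurve.degS n P ∧ N.degree ≤ P.degree) ∧
      (∀ M : Fin 4 →₀ ℕ, 0 ∉ M.support →
        M i < MonomialCurve.critExp n i → MonomialCurve.critExp n j ≤ M j →
        M k < MonomialCurve.critExp n k →
        (∃ s ∈ MonomialCurve.semigroup n, MonomialCurve.degS n M = n 0 + s) →
          ∃ N : Fin 4 →₀ ℕ, 0 ∈ N.support ∧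
            MonomialCurve.mon K M - MonomialCurve.mon K N ∈ MonomialCurve.toricIdeal K n ∧
            M.degree ≤ N.degree) := by
  have hn : ∀ l, 0 < n l := fun l => hpos.trans_le (hmono.monotone (Fin.zero_le l))
  rw [MonomialCurve.hasCohenMacaulayTangentCone_iff hpos hmono,
    ← MonomialCurve.liftsToZero_iff hn]
  constructor
  · intro h
    refine ⟨fun M N hf h0 => MonomialCurve.degree_le_of_mem_setI hn h hf h0,
      fun M N hf h0 => ?_, fun M _ _ _ _ hs => ?_⟩
    · obtain ⟨P, hP0, hP, hd⟩ := h N M (Nat.pos_of_ne_zero (Finsupp.mem_support_iff.1 h0))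
        (MonomialCurve.mon_sub_mon_mem_toricIdeal.1 hf.1)
      exact ⟨P, Finsupp.mem_support_iff.2 hP0.ne', hP.symm, hd⟩
    · obtain ⟨s, hs, hM⟩ := hs
      obtain ⟨u, rfl⟩ := MonomialCurve.mem_semigroup.1 hs
      obtain ⟨N, hN0, hN, hd⟩ := h M (Finsupp.single 0 1 + u) (by simp)
        (by rw [MonomialCurve.degS_add, MonomialCurve.degS_single, one_mul, hM])
      exact ⟨N, Finsupp.mem_support_iff.2 hN0.ne',
        MonomialCurve.mon_sub_mon_mem_toricIdeal.2 hN.symm, hd⟩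
  · rintro ⟨h1, h2, h3⟩
    exact hcase.liftsToZero hpos hmono hjk h1 h2 h3
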